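/- **Setting.** For $s\in\mathbb R$ let $\omega_0^s=1$, $\omega_k^s=k^s$ ($k\ge1$), and let $\Omega^s$ be the normed space of real sequences $x=(x_k)_{k\ge0}$ with $\|x\|_s=\sup_k|x_k|\omega_k^s<\infty$; $B_0(r)=\{x\in\Omega^s:\|x\|_s\le r\}$. Let $(x*y)_k=\sum_{k_1+k_2=k,\;k_i\in\mathbb Z}x_{|k_1|}y_{|k_2|}$. Fix $s\ge2$, $s_L>0$, $\sigma\in\mathbb R$, $g\in\Omega^s$ and real sequences $(\lambda_k),(\mu_k),(\beta_k)$ for which there are $0<C_1\le C_2$, $k_0\ge0$ and $\delta\in(0,\frac12)$ with $$|\lambda_k|,|\mu_k|,|\beta_k|\le C_2\,\omega_k^{s_L}\ (k\ge0),\qquad |\mu_k|\ge C_1\omega_k^{s_L},\quad |\lambda_k/\mu_k|,|\beta_k/\mu_k|\le\delta\ (k\ge k_0).$$ Put $\mathcal L_0(x)=\mu_0x_0+\beta_0x_1$, $\mathcal L_k(x)=\lambda_kx_{k-1}+\mu_kx_k+\beta_kx_{k+1}$ ($k\ge1$) and $f(x)=\mathcal L(x)+\sigma(x*x)+g$. Let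 $m\ge\max(6,k_0)$, let $\bar x=(\bar x_0,\dots,\bar x_{m-1},0,0,\dots)$, let $f^{(m)}:\mathbb R^m\to\mathbb R^m$ be the truncation $x_F\mapsto(f(x_F,0,0,\dots)_k)_{k<m}$, and $D=Df^{(m)}(\bar x)$. Write $x_F=(x_0,\dots,x_{m-1})$, $x_I=(x_m,x_{m+1},\dots)$. Let $A^\dagger$ be the linear operator with $(A^\dagger z)_F=Dz_F+\beta_{m-1}z_m e_{m-1}$, where $e_{m-1}$ is the last unit vector of $\mathbb R^m$, and $(A^\dagger z)_k=\mathcal L_k(z)$ for $k\ge m$. **The operators $A$ and $T$.** Put $a_n=\lambda_{m+n-1}$, $b_n=\mu_{m+n-1}$, $c_n=\beta_{m+n-1}$, $\delta_0=1$, $\delta_1=b_1$, $\delta_n=b_n\delta_{n-1}-a_nc_{n-1}\delta_{n-2}$ and, for $k\ge 0$, $$(L_I^{-1}y_I)_k=y_{m+k}+\sum_{l=1}^k(-1)^la_{k-l+2}\cdots a_{k+1}\tfrac{\delta_{k-l}}{\delta_k}y_{m+k-l},\qquad (U_I^{-1}z_I)_k=\tfrac{\delta_k}{\delta_{k+1}}z_{m+k}+\sum_{l\ge1}(-1)^l\tfrac{\delta_k}{\delta_{k+l+1}}c_{k+1}\cdots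 c_{k+l}z_{m+k+l}.$$ Put $Q=U_I^{-1}L_I^{-1}$, $w=Q\,(1,0,0,\dots)^T$ with entries $w_0,w_1,\dots$. For an integer $L\ge0$ let $\tilde w=\frac{\delta_0}{\delta_1}+\sum_{l=1}^{L-1}\frac{\delta_0^2}{\delta_l\delta_{l+1}}c_1\cdots c_l\,a_2\cdots a_{l+1}$, and let $\tilde K$ be $D$ with $\beta_{m-1}\lambda_m\tilde w$ subtracted from its entry $(m-1,m-1)$. Let $A_m$ be any real $m\times m$ matrix (in practice a numerical inverse of $\tilde K$), with last column $(A_m)_{c}$, last row $(A_m)_{r}$ and last diagonal entry $\alpha_*=(A_m)_{m-1,m-1}$. Let $$(Ay)_F=A_my_F-\beta_{m-1}(Qy_I)_0(A_m)_{c},\qquad (Ay)_{m+k}=-\lambda_m\big((A_m)_{r}\,y_F\big)w_k+(Qy_I)_k+\beta_{m-1}\lambda_m\alpha_*(Qy_I)_0w_k,$$ and $T(x)=x-Af(x)$. **Constants.** Let $\gamma=\frac12+\sqrt{\frac14-\delta^2}$, $\theta=\delta/\gamma$, $\eta=\frac1{\gamma(1-\theta^2)}$. Let $M$ be an integer with $$(M_A)\quad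 M\ge\max\Big(\tfrac{-m\ln\sqrt\theta-s-s_L-1-\sqrt{(m\ln\sqrt\theta+s+s_L+1)^2-4m\ln\sqrt\theta}}{2\ln\sqrt\theta},\tfrac4{(\ln\theta)^2},m\Big),\qquad (M_Y)\quad M\ge\max\Big(\tfrac{-s}{\ln\theta}-m,\;m-2\Big),$$ $$\chi=\theta^{M/2}\tfrac M2\big(\tfrac{m+M}m\big)^{s+s_L}+\theta^{\sqrt M}\tfrac M2 2^{s+s_L}+\tfrac1{1-\theta}\big(\tfrac{m+M}{m+M-\sqrt M-1}\big)^{s+s_L}.$$ For an integer $N\ge1$ let $S=2\sum_{l=1}^Nl^{-s}+\frac2{(s-1)N^{s-1}}$ and $\alpha_0=1+S$, $\alpha_k=2+S+\sum_{l=1}^{k-1}\frac{k^s}{l^s(k-l)^s}$ for $1\le k<m$, and $\alpha_k=2+S+2\big(\frac m{m-1}\big)^s+\big(\frac{4\ln(m-2)}m+\frac{\pi^2-6}3\big)\big(\frac2m+\frac12\big)^{s-2}$ for $k\ge m$. **The bounds.** Absolute values of vectors and matrices, and inequalities between them, are componentwise. Let $W=(1/\omega_0^s,\dots,1/\omega_{m-1}^s)^T$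 and $\varepsilon=\frac{|\beta_{m-1}||\lambda_m|\theta^{2L}}{|\mu_m|\,\omega_{m-1}^s(1-\theta^2)}$. Then $$Z^1_F(r)=\big(|I-A_m\tilde K|W+\varepsilon|(A_m)_{c}|\big)r,\qquad Z^1_{m+k}(r)=\big((|I-A_m\tilde K|W)_{m-1}+\varepsilon|\alpha_*|\big)\eta\theta^k\tfrac{|\lambda_m|}{|\mu_m|}r\ \ (0\le k\le M),$$ and $Z^1_{m+k}=Z^1_{m+M}\,\omega_{m+M}^s/\omega_{m+k}^s$ for $k>M$. Let $C^1_k=2|\sigma|\sum_{l=m-k}^{m-1}|\bar x_l|/\omega_{k+l}^s$ and $C^2_k=2|\sigma|\alpha_k/\omega_k^s$ for $0\le k<m$, $\kappa_1=2|\sigma|\alpha_m\|\bar x\|_s$, $\kappa_2=2|\sigma|\alpha_m$. For $i=1,2$ put $q_i=\frac{|\beta_{m-1}|\,\eta\,\kappa_i}{C_1(1-\theta)\,\omega_m^{s+s_L}}$ and $$D^i_F=|A_m|C^i_F+q_i|(A_m)_{c}|,\qquad D^i_{m+k}=\big(|(A_m)_{r}|C^i_F+q_i|\alpha_*|\big)\eta\tfrac{|\lambda_m|}{|\mu_m|}\theta^k+\tfrac{\eta\kappa_i}{C_1\omega_{m+k}^{s+s_L}}\Big(E_k+\tfrac\theta{1-\theta}\Big)\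 \ (0\le k\le M),$$ with $E_k=\sum_{l=0}^k\theta^{k-l}\big(\frac{m+k}{m+l}\big)^{s+s_L}$ for $k<M$ and $E_M=\chi$, and $D^i_{m+k}=D^i_{m+M}\,\omega_{m+M}^s/\omega_{m+k}^s$ for $k>M$. Finally let $Z^2(r)=D^1r+D^2r^2$ and $Z(r)=Z^1(r)+Z^2(r)$. **Claim.** $f$ maps $\Omega^s$ into $\Omega^{s-s_L}$, $T$ maps $\Omega^s$ into $\Omega^s$, both maps are Fréchet differentiable, and for all $r>0$ and all $y,z\in B_0(r)$, componentwise, $$\big|(I-AA^\dagger)z\big|\le Z^1(r),\qquad \big|A\big(Df(\bar x+y)-A^\dagger\big)z\big|\le Z^2(r),\qquad \big|DT(\bar x+y)z\big|\le Z(r).$$ -/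

import Mathlib

namespace TridiagNewton

noncomputable section

/-! ## The weighted sequence spaces `Ω^s` -/

/-- The weight `ω_k^s`: it is `1` for `k = 0` and `k^s` for `k ≥ 1`. -/
def wt (s : ℝ) (k : ℕ) : ℝ := if k = 0 then 1 else (k : ℝ) ^ s

theorem wt_pos (s : ℝ) (k : ℕ) : 0 < wt s k := by
  unfold wt
  split_ifs with h
  · exact one_pos
  · exact Real.rpow_pos_of_pos (by exact_mod_cast Nat.pos_of_ne_zero h) s

/-- `x ∈ Ω^s`, that is `sup_k |x_k| ω_k^s < ∞`. -/
def MemOmega (s : ℝ) (x : ℕ → ℝ) : Prop :=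
  BddAbove (Set.range fun k => |x k| * wt s k)

/-- `‖x‖_s = sup_k |x_k| ω_k^s`. -/
def omegaNorm (s : ℝ) (x : ℕ → ℝ) : ℝ := ⨆ k, |x k| * wt s k

theorem memOmega_iff {s : ℝ} {x : ℕ → ℝ} :
    MemOmega s x ↔ ∃ C, ∀ k, |x k| * wt s k ≤ C := by
  constructor
  · rintro ⟨C, hC⟩
    exact ⟨C, fun k => hC ⟨k, rfl⟩⟩
  · rintro ⟨C, hC⟩
    refine ⟨C, ?_⟩
    rintro _ ⟨k, rfl⟩
    exact hC k

theorem le_omegaNorm {s : ℝ} {x : ℕ → ℝ} (hx : MemOmega s x) (k : ℕ) :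
    |x k| * wt s k ≤ omegaNorm s x :=
  le_ciSup hx k

theorem abs_add_mul_le {s : ℝ} (x y : ℕ → ℝ) (k : ℕ) :
    |x k + y k| * wt s k ≤ |x k| * wt s k + |y k| * wt s k := by
  rw [← add_mul]
  exact mul_le_mul_of_nonneg_right (abs_add_le _ _) (wt_pos s k).le

/-- `Ω^s` as a vector space of real sequences. -/
def omegaSubmodule (s : ℝ) : Submodule ℝ (ℕ → ℝ) where
  carrier := {x | MemOmega s x}
  zero_mem' := memOmega_iff.2 ⟨0, fun k => by simp⟩
  add_mem' := by
    intro x y hx hy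
    exact memOmega_iff.2 ⟨omegaNorm s x + omegaNorm s y, fun k =>
      (abs_add_mul_le x y k).trans (add_le_add (le_omegaNorm hx k) (le_omegaNorm hy k))⟩
  smul_mem' := by
    intro c x hx
    refine memOmega_iff.2 ⟨|c| * omegaNorm s x, fun k => ?_⟩
    simp only [Pi.smul_apply, smul_eq_mul, abs_mul, mul_assoc]
    exact mul_le_mul_of_nonneg_left (le_omegaNorm hx k) (abs_nonneg c)

/-- The normed space `Ω^s`. It is not reducible to a subtype of `ℕ → ℝ`, so that its topology is
that of the norm `‖·‖_s` and not the one of pointwise convergence. -/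
def Omega (s : ℝ) : Type := omegaSubmodule s

instance (s : ℝ) : AddCommGroup (Omega s) := inferInstanceAs (AddCommGroup (omegaSubmodule s))

instance (s : ℝ) : Module ℝ (Omega s) := inferInstanceAs (Module ℝ (omegaSubmodule s))

/-- The sequence underlying an element of `Ω^s`. -/
def Omega.seq {s : ℝ} (x : Omega s) : ℕ → ℝ := x.1

theorem Omega.mem {s : ℝ} (x : Omega s) : MemOmega s x.seq := x.2

/-- A sequence in `Ω^s`, as an element of the space. -/
def Omega.mk {s : ℝ} (x : ℕ → ℝ) (hx : MemOmega s x) : Omega s := ⟨x, hx⟩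

theorem Omega.ext {s : ℝ} {x y : Omega s} (h : ∀ k, x.seq k = y.seq k) : x = y :=
  Subtype.ext (funext h)

instance (s : ℝ) : Norm (Omega s) := ⟨fun x => omegaNorm s x.seq⟩

theorem omega_normedSpaceCore (s : ℝ) : NormedSpace.Core ℝ (Omega s) where
  norm_nonneg x := Real.iSup_nonneg fun k => mul_nonneg (abs_nonneg _) (wt_pos s k).le
  norm_smul c x := by
    change (⨆ k, |c * x.seq k| * wt s k) = |c| * ⨆ k, |x.seq k| * wt s k
    rw [Real.mul_iSup_of_nonneg (abs_nonneg c)]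
    simp only [abs_mul, mul_assoc]
  norm_triangle x y := by
    refine ciSup_le fun k => (abs_add_mul_le x.seq y.seq k).trans ?_
    exact add_le_add (le_omegaNorm x.mem k) (le_omegaNorm y.mem k)
  norm_eq_zero_iff x := by
    constructor
    · intro h
      refine Omega.ext fun k => ?_
      have h1 : |x.seq k| * wt s k ≤ 0 := (le_omegaNorm x.mem k).trans_eq h
      have h2 : |x.seq k| ≤ 0 := by
        by_contra hc
        exact absurd h1 (not_le.2 (mul_pos (not_le.1 hc) (wt_pos s k)))
      exact abs_nonpos_iff.1 h2
    · rintro rfl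
      change (⨆ k, |(0 : ℝ)| * wt s k) = 0
      simp

instance (s : ℝ) : NormedAddCommGroup (Omega s) :=
  NormedAddCommGroup.ofCore (omega_normedSpaceCore s)

instance (s : ℝ) : NormedSpace ℝ (Omega s) := NormedSpace.ofCore (omega_normedSpaceCore s)

/-! ## The discrete convolution -/

/-- `(x * y)_k = ∑_{k₁ + k₂ = k} x̃_{k₁} ỹ_{k₂}` over all integers `k₁, k₂`, where `x̃, ỹ` are the
even extensions of `x, y` to `ℤ`. -/
def conv (x y : ℕ → ℝ) (k : ℕ) : ℝ := ∑' j : ℤ, x j.natAbs * y ((k : ℤ) - j).natAbs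

/-- The constants `α_k^s(n)` of the convolution estimate, with computational parameter `N`. -/
def alpha (s : ℝ) (n N k : ℕ) : ℝ :=
  if k = 0 then
    1 + 2 * ∑ l ∈ Finset.Icc 1 N, 1 / (l : ℝ) ^ s + 2 / ((s - 1) * (N : ℝ) ^ (s - 1))
  else if k < n then
    2 + 2 * ∑ l ∈ Finset.Icc 1 N, 1 / (l : ℝ) ^ s + 2 / ((s - 1) * (N : ℝ) ^ (s - 1))
      + ∑ l ∈ Finset.Icc 1 (k - 1), (k : ℝ) ^ s / ((l : ℝ) ^ s * ((k : ℝ) - l) ^ s)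
  else
    2 + 2 * ∑ l ∈ Finset.Icc 1 N, 1 / (l : ℝ) ^ s + 2 / ((s - 1) * (N : ℝ) ^ (s - 1))
      + 2 * ((n : ℝ) / ((n : ℝ) - 1)) ^ s
      + (4 * Real.log ((n : ℝ) - 2) / n + (Real.pi ^ 2 - 6) / 3)
        * (2 / (n : ℝ) + 1 / 2) ^ (s - 2)

/-! ## The data of the problem -/

/-- The data: the decay rate `s`, the order `sL` of the tridiagonal part, its coefficients
`λ, μ, β`, the nonlinearity `N(x) = σ (x * x) + g`, the constants `δ` and `C₁` of the growth
assumptions, the size `m` of the projection, the numerical approximation `x̄`, the numerical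
inverse `A_m` and the computational parameters `L` (truncation of `(w_I)_0`) and `N`
(truncation in the convolution estimate). -/
structure Data where
  s : ℝ
  sL : ℝ
  lam : ℕ → ℝ
  mu : ℕ → ℝ
  beta : ℕ → ℝ
  sigma : ℝ
  g : ℕ → ℝ
  delta : ℝ
  C1 : ℝ
  m : ℕ
  m_pos : 0 < m
  xbar : Fin m → ℝ
  Am : Matrix (Fin m) (Fin m) ℝ
  L : ℕ
  N : ℕ

namespace Data

variable (P : Data)

/-- The growth assumptions on the tridiagonal part, with constants `C₁ ≤ C₂`, `δ` and `k₀`. -/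
structure Assumptions (C2 : ℝ) (k0 : ℕ) : Prop where
  C1_pos : 0 < P.C1
  C1_le_C2 : P.C1 ≤ C2
  lam_le : ∀ k, |P.lam k / wt P.sL k| ≤ C2
  mu_le : ∀ k, |P.mu k / wt P.sL k| ≤ C2
  beta_le : ∀ k, |P.beta k / wt P.sL k| ≤ C2
  le_mu : ∀ k, k0 ≤ k → P.C1 ≤ |P.mu k / wt P.sL k|
  delta_pos : 0 < P.delta
  delta_lt : P.delta < 1 / 2
  lam_ratio : ∀ k, k0 ≤ k → |P.lam k / P.mu k| ≤ P.delta
  beta_ratio : ∀ k, k0 ≤ k → |P.beta k / P.mu k| ≤ P.delta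

/-- The tridiagonal operator `𝓛`. -/
def tri (x : ℕ → ℝ) : ℕ → ℝ
  | 0 => P.mu 0 * x 0 + P.beta 0 * x 1
  | k + 1 => P.lam (k + 1) * x k + P.mu (k + 1) * x (k + 1) + P.beta (k + 1) * x (k + 2)

/-- `f(x) = 𝓛(x) + N(x)` with the quadratic nonlinearity `N(x) = σ (x * x) + g`. -/
def f (x : ℕ → ℝ) (k : ℕ) : ℝ := P.tri x k + (P.sigma * conv x x k + P.g k)

/-- A finite vector `x_F`, identified with the sequence `(x_F, 0, 0, …)`. -/
def pad (x : Fin P.m → ℝ) (k : ℕ) : ℝ := if h : k < P.m then x ⟨k, h⟩ else 0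

theorem memOmega_pad (t : ℝ) (x : Fin P.m → ℝ) : MemOmega t (P.pad x) := by
  refine memOmega_iff.2 ⟨∑ i : Fin P.m, |x i| * wt t i, fun k => ?_⟩
  have h0 : ∀ i : Fin P.m, 0 ≤ |x i| * wt t i := fun i =>
    mul_nonneg (abs_nonneg _) (wt_pos t i).le
  unfold pad
  split_ifs with h
  · exact Finset.single_le_sum (f := fun i : Fin P.m => |x i| * wt t i)
      (fun i _ => h0 i) (Finset.mem_univ (⟨k, h⟩ : Fin P.m))
  · simpa using Finset.sum_nonneg fun i (_ : i ∈ Finset.univ) => h0 i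

/-- The numerical approximation `x̄` as an element of `Ω^s`. -/
def xbarOmega : Omega P.s := Omega.mk (P.pad P.xbar) (P.memOmega_pad P.s P.xbar)

/-- The finite dimensional projection `f^{(m)} : ℝ^m → ℝ^m` of `f`. -/
def fm (x : Fin P.m → ℝ) (i : Fin P.m) : ℝ := P.f (P.pad x) i

/-- `D = Df^{(m)}(x̄)`, the Jacobian matrix. -/
def D : Matrix (Fin P.m) (Fin P.m) ℝ :=
  LinearMap.toMatrix' (fderiv ℝ P.fm P.xbar : (Fin P.m → ℝ) →ₗ[ℝ] (Fin P.m → ℝ))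

/-- The index `m - 1`. -/
def last : Fin P.m := ⟨P.m - 1, Nat.sub_lt P.m_pos one_pos⟩

/-- The operator `A†`: the block `D` coupled to the tridiagonal tail. -/
def Adag (z : ℕ → ℝ) (k : ℕ) : ℝ :=
  if h : k < P.m then
    (∑ j, P.D ⟨k, h⟩ j * z j) + (if k = P.m - 1 then P.beta (P.m - 1) * z P.m else 0)
  else P.tri z k

/-! ### The LU-decomposition of the tail -/

/-- `a_n = λ_{m+n-1}`, for `n ≥ 2`. -/
def a (n : ℕ) : ℝ := P.lam (P.m + n - 1)

/-- `b_n = μ_{m+n-1}`, for `n ≥ 1`. -/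
def b (n : ℕ) : ℝ := P.mu (P.m + n - 1)

/-- `c_n = β_{m+n-1}`, for `n ≥ 1`. -/
def c (n : ℕ) : ℝ := P.beta (P.m + n - 1)

/-- The leading principal minors `δ_n` of the tail. -/
def dlt : ℕ → ℝ
  | 0 => 1
  | 1 => P.b 1
  | n + 2 => P.b (n + 2) * dlt (n + 1) - P.a (n + 2) * P.c (n + 1) * dlt n

/-- `L_I^{-1} y_I`; tails `(y_m, y_{m+1}, …)` are indexed from `0`. -/
def LIinv (y : ℕ → ℝ) (k : ℕ) : ℝ :=
  y k + ∑ l ∈ Finset.Icc 1 k,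
    (-1) ^ l * (∏ i ∈ Finset.Icc (k - l + 2) (k + 1), P.a i) * (P.dlt (k - l) / P.dlt k) * y (k - l)

/-- `U_I^{-1} z_I`; the series over `l ≥ 1` is written with `l + 1`, `l ≥ 0`. -/
def UIinv (z : ℕ → ℝ) (k : ℕ) : ℝ :=
  P.dlt k / P.dlt (k + 1) * z k + ∑' l : ℕ,
    (-1) ^ (l + 1) * (P.dlt k / P.dlt (k + (l + 1) + 1))
      * (∏ i ∈ Finset.Icc (k + 1) (k + (l + 1)), P.c i) * z (k + (l + 1))

/-- `U_I^{-1} L_I^{-1} y_I`. -/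
def tailInv (y : ℕ → ℝ) : ℕ → ℝ := P.UIinv (P.LIinv y)

/-- `w_I = U_I^{-1} L_I^{-1} e_1`. -/
def w : ℕ → ℝ := P.tailInv (Pi.single 0 1)

/-- `w̃`, the truncation of the series of `(w_I)_0`. -/
def wtilde : ℝ :=
  P.dlt 0 / P.dlt 1 + ∑ l ∈ Finset.Ico 1 P.L,
    P.dlt 0 ^ 2 / (P.dlt l * P.dlt (l + 1))
      * (∏ i ∈ Finset.Icc 1 l, P.c i) * ∏ i ∈ Finset.Icc 2 (l + 1), P.a i

/-- `K̃ = D - β_{m-1} λ_m w̃ E_{m-1,m-1}`. -/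
def Ktilde : Matrix (Fin P.m) (Fin P.m) ℝ :=
  P.D - (P.beta (P.m - 1) * P.lam P.m) • Matrix.single P.last P.last P.wtilde

/-- The tail `y_I = (y_m, y_{m+1}, …)`. -/
def tail (y : ℕ → ℝ) (k : ℕ) : ℝ := y (P.m + k)

/-- The approximate inverse `A` of `A†`, built from `A_m`. -/
def A (y : ℕ → ℝ) (k : ℕ) : ℝ :=
  if h : k < P.m then
    (∑ j, P.Am ⟨k, h⟩ j * y j)
      - P.beta (P.m - 1) * (P.Am ⟨k, h⟩ P.last * P.tailInv (P.tail y) 0)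
  else
    -P.lam P.m * (P.w (k - P.m) * ∑ j, P.Am P.last j * y j)
      + P.tailInv (P.tail y) (k - P.m)
      + P.beta (P.m - 1) * P.lam P.m * P.Am P.last P.last
        * (P.w (k - P.m) * P.tailInv (P.tail y) 0)

/-- The Newton-like operator `T(x) = x - A f(x)`. -/
def T (x : ℕ → ℝ) (k : ℕ) : ℝ := x k - P.A (P.f x) k

/-! ### The constants -/

/-- `γ = 1/2 + √(1/4 - δ²)`. -/
def gamma : ℝ := 1 / 2 + Real.sqrt (1 / 4 - P.delta ^ 2)

/-- `θ = δ / γ`. -/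
def theta : ℝ := P.delta / P.gamma

/-- `η = 1 / (γ (1 - θ²))`. -/
def eta : ℝ := 1 / (P.gamma * (1 - P.theta ^ 2))

/-- `χ = χ(θ, m, M, s, s_L)`. -/
def chi (M : ℕ) : ℝ :=
  P.theta ^ ((M : ℝ) / 2) * ((M : ℝ) / 2) * (((P.m : ℝ) + M) / P.m) ^ (P.s + P.sL)
    + P.theta ^ Real.sqrt M * ((M : ℝ) / 2) * (2 : ℝ) ^ (P.s + P.sL)
    + 1 / (1 - P.theta)
      * (((P.m : ℝ) + M) / ((P.m : ℝ) + M - Real.sqrt M - 1)) ^ (P.s + P.sL)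

/-- The condition `(M_A)`. -/
def CondMA (M : ℕ) : Prop :=
  max (max
    ((-P.m * Real.log (Real.sqrt P.theta) - P.s - P.sL - 1
        - Real.sqrt ((P.m * Real.log (Real.sqrt P.theta) + P.s + P.sL + 1) ^ 2
            - 4 * P.m * Real.log (Real.sqrt P.theta)))
      / (2 * Real.log (Real.sqrt P.theta)))
    (4 / Real.log P.theta ^ 2)) (P.m : ℝ) ≤ M

/-- The condition `(M_Y)`. -/
def CondMY (M : ℕ) : Prop :=
  max (-P.s / Real.log P.theta - P.m) ((P.m : ℝ) - 2) ≤ M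

/-! ### The bounds -/

/-- The common factor `|β_{m-1}| |λ_m| θ^{2L} / (|μ_m| ω_{m-1}^s (1 - θ²))` of `Z¹`, which
accounts for the truncation error of `w̃`. -/
def truncErr : ℝ :=
  |P.beta (P.m - 1)| * |P.lam P.m| * P.theta ^ (2 * P.L)
    / (|P.mu P.m| * wt P.s (P.m - 1) * (1 - P.theta ^ 2))

/-- `|I - A_m K̃| W_F^s`. -/
def defect (i : Fin P.m) : ℝ :=
  ∑ j : Fin P.m, |(1 - P.Am * P.Ktilde) i j| * (1 / wt P.s j)

/-- The value of `Z¹_{m+k}` for `0 ≤ k ≤ M`. -/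
def Z1tail (r : ℝ) (k : ℕ) : ℝ :=
  (P.defect P.last + P.truncErr * |P.Am P.last P.last|)
    * P.eta * P.theta ^ k * (|P.lam P.m| / |P.mu P.m|) * r

/-- The bound `Z¹(r)`. -/
def Z1 (M : ℕ) (r : ℝ) (k : ℕ) : ℝ :=
  if h : k < P.m then
    (P.defect ⟨k, h⟩ + P.truncErr * |P.Am ⟨k, h⟩ P.last|) * r
  else if k - P.m ≤ M then P.Z1tail r (k - P.m)
  else P.Z1tail r M * (wt P.s (P.m + M) / wt P.s k)

/-- The finite part `C¹_F(x̄)`; the sum is empty for `k = 0`. -/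
def C1F (k : Fin P.m) : ℝ :=
  2 * |P.sigma| * ∑ l ∈ Finset.Icc (P.m - k) (P.m - 1), |P.pad P.xbar l| / wt P.s (k + l)

/-- The finite part `C²_F`. -/
def C2F (k : Fin P.m) : ℝ := 2 * |P.sigma| * alpha P.s P.m P.N k / wt P.s k

/-- The part of `D^i_{m+k}` that is due to the coupling with the finite block. Here `C` is the
finite part of `C^i`, and `κ` is the constant with `C^i_{m+k} = κ / ω_{m+k}^s`. -/
def Dcoupling (C : Fin P.m → ℝ) (κ : ℝ) (k : ℕ) : ℝ :=
  ((∑ j, |P.Am P.last j| * C j)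
    + |P.beta (P.m - 1)| * |P.Am P.last P.last| * P.eta * κ
      / (P.C1 * (1 - P.theta) * wt (P.s + P.sL) P.m))
    * P.eta * (|P.lam P.m| / |P.mu P.m|) * P.theta ^ k

/-- The value at the index `m + M`. -/
def DatM (C : Fin P.m → ℝ) (κ : ℝ) (M : ℕ) : ℝ :=
  P.Dcoupling C κ M
    + P.eta * κ / (P.C1 * wt (P.s + P.sL) (P.m + M))
      * (P.chi M + P.theta / (1 - P.theta))

/-- The common shape of `D¹` and `D²`. -/
def Dbound (C : Fin P.m → ℝ) (κ : ℝ) (M k : ℕ) : ℝ :=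
  if h : k < P.m then
    (∑ j, |P.Am ⟨k, h⟩ j| * C j)
      + |P.beta (P.m - 1)| * P.eta * κ / (P.C1 * (1 - P.theta) * wt (P.s + P.sL) P.m)
        * |P.Am ⟨k, h⟩ P.last|
  else if k - P.m < M then
    P.Dcoupling C κ (k - P.m)
      + P.eta * κ / (P.C1 * wt (P.s + P.sL) k)
        * ((∑ l ∈ Finset.range (k - P.m + 1),
              P.theta ^ (k - P.m - l) * ((k : ℝ) / ((P.m : ℝ) + l)) ^ (P.s + P.sL))
            + P.theta / (1 - P.theta))
  else if k - P.m = M then P.DatM C κ M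
  else P.DatM C κ M * (wt P.s (P.m + M) / wt P.s k)

/-- The bound `D¹(x̄)`. -/
def D1 (M k : ℕ) : ℝ :=
  P.Dbound P.C1F
    (2 * |P.sigma| * alpha P.s P.m P.N P.m * omegaNorm P.s (P.pad P.xbar)) M k

/-- The bound `D²`. -/
def D2 (M k : ℕ) : ℝ :=
  P.Dbound P.C2F (2 * |P.sigma| * alpha P.s P.m P.N P.m) M k

/-- The bound `Z²(r) = D¹(x̄) r + D² r²`. -/
def Z2 (M : ℕ) (r : ℝ) (k : ℕ) : ℝ := P.D1 M k * r + P.D2 M k * r ^ 2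

/-- The bound `Z(r) = Z¹(r) + Z²(r)`. -/
def Z (M : ℕ) (r : ℝ) (k : ℕ) : ℝ := P.Z1 M r k + P.Z2 M r k

end Data

end

end TridiagNewton

/-!
Beyond row `m` the tridiagonal operator is diagonally dominant with ratio `δ < 1/2`. Since
`γ² = γ - δ²`, elimination keeps every pivot `δ_{n+1} / δ_n` at least `γ |b_{n+1}|` in absolute
value, so the multipliers of both triangular factors are at most `θ = δ / γ`, the kernels of
`L_I⁻¹` and `U_I⁻¹` decay geometrically, and `Q = U_I⁻¹ L_I⁻¹` inverts the tail.

Consequently `I - A A†` only sees `I - A_m K̃` and the truncation error `w_0 - w̃`, which is the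
remainder of a series with ratio `θ²`. Applied to a sequence of size `κ / ω_k^s`, the tail of `A`
is dominated by a convolution of the weights `ω^{s + s_L}` with powers of `θ`, which `χ` bounds
uniformly: terms near the diagonal feel a nearly constant weight, the others a small power of `θ`.

`Df(x̄ + y) - A†` consists only of the convolutions of `x̄` and `y` with `z`, whose entries are at
most `α_k / ω_k^s` times the norms of the factors. This bilinear bound also makes `f`, and with
the bounded linear `A` the map `T`, differentiable.
-/

namespace TridiagNewton

/-! ### Weighted sequence spaces -/

theorem abs_mul_le_of_le {u v U V : ℝ} (hu : |u| ≤ U) (hv : |v| ≤ V) : |u * v| ≤ U * V :=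
  norm_mul_le_of_le (a₁ := u) (a₂ := v) hu hv

section Weights

variable {s t : ℝ}

theorem wt_zero (s : ℝ) : wt s 0 = 1 := if_pos rfl

theorem wt_of_pos {k : ℕ} (hk : 0 < k) : wt s k = (k : ℝ) ^ s := if_neg hk.ne'

theorem wt_succ (s : ℝ) (k : ℕ) : wt s (k + 1) = ((k : ℝ) + 1) ^ s := by
  rw [wt_of_pos k.succ_pos, Nat.cast_succ]

theorem one_le_wt (hs : 0 ≤ s) (k : ℕ) : 1 ≤ wt s k := by
  cases k with
  | zero => exact (wt_zero s).ge
  | succ k => exact (Real.one_le_rpow (by simp) hs).trans_eq (wt_succ s k).symm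

theorem wt_le_wt_of_exponent_le (h : s ≤ t) (k : ℕ) : wt s k ≤ wt t k := by
  cases k with
  | zero => simp only [wt_zero, le_refl]
  | succ k =>
    rw [wt_succ, wt_succ]
    exact Real.rpow_le_rpow_of_exponent_le (by simp) h

theorem wt_add (s t : ℝ) (k : ℕ) : wt (s + t) k = wt s k * wt t k := by
  cases k with
  | zero => simp only [wt_zero, mul_one]
  | succ k => simp only [wt_succ, Real.rpow_add k.cast_add_one_pos]

theorem wt_mono (hs : 0 ≤ s) : Monotone (wt s) := by
  intro j k h
  rcases Nat.eq_zero_or_pos j with rfl | hj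
  · exact (wt_zero s).trans_le (one_le_wt hs k)
  · rw [wt_of_pos hj, wt_of_pos (hj.trans_le h)]
    gcongr

theorem wt_succ_le (hs : 0 ≤ s) (k : ℕ) : wt s (k + 1) ≤ 2 ^ s * wt s k := by
  rcases Nat.eq_zero_or_pos k with rfl | hk
  · simpa [wt] using Real.one_le_rpow one_le_two hs
  · rw [wt_succ, wt_of_pos hk, ← Real.mul_rpow zero_le_two k.cast_nonneg]
    have : (1 : ℝ) ≤ k := by exact_mod_cast hk
    gcongr
    linarith

theorem wt_add_left {m : ℕ} (hm : 0 < m) (s : ℝ) (n : ℕ) : wt s (m + n) = ((m : ℝ) + n) ^ s := by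
  rw [wt_of_pos (by omega), Nat.cast_add]

theorem nonneg_of_abs_le_div_wt {s κ u : ℝ} {k : ℕ} (h : |u| ≤ κ / wt s k) : 0 ≤ κ := by
  have := (abs_nonneg _).trans h
  rwa [le_div_iff₀ (wt_pos _ _), zero_mul] at this

theorem inv_wt_add_le {s t : ℝ} (ht : 0 ≤ t) {k n : ℕ} (hkn : k ≤ n) :
    (wt (s + t) n)⁻¹ ≤ (wt (s + t) k)⁻¹ * (wt s k / wt s n) := by
  have hs := (wt_pos s k).ne'
  calc (wt (s + t) n)⁻¹ = (wt s n)⁻¹ * (wt t n)⁻¹ := by rw [wt_add, mul_inv]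
    _ ≤ (wt s n)⁻¹ * (wt t k)⁻¹ := by
        have := wt_pos t k
        have := (wt_pos s n).le
        gcongr
        exact wt_mono ht hkn
    _ = _ := by
        rw [wt_add]
        field_simp

theorem abs_le_of_abs_le_div_wt {s r : ℝ} (hs : 0 ≤ s) {x : ℕ → ℝ}
    (hx : ∀ k, |x k| ≤ r / wt s k) (k : ℕ) : |x k| ≤ r :=
  (hx k).trans (div_le_self (nonneg_of_abs_le_div_wt (hx k)) (one_le_wt hs k))

theorem abs_mul_le_div_wt {s t A D r a u : ℝ} {j k : ℕ} (ha : |a / wt t k| ≤ A)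
    (hu : |u| ≤ r / wt s j) (hjk : wt s k ≤ D * wt s j) :
    |a * u| ≤ A * (D * r) / wt (s - t) k := by
  have hw : wt s k = wt (s - t) k * wt t k := by rw [← wt_add, sub_add_cancel]
  have huk : |u| ≤ D * r / wt s k := by
    refine hu.trans ?_
    rw [div_le_div_iff₀ (wt_pos s j) (wt_pos s k), mul_right_comm, mul_comm _ r]
    exact mul_le_mul_of_nonneg_left hjk (nonneg_of_abs_le_div_wt hu)
  have hmul := mul_le_mul_of_nonneg_right (abs_mul_le_of_le ha huk) (wt_pos t k).le
  have := (wt_pos t k).ne'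
  have := (wt_pos (s - t) k).ne'
  calc |a * u| = |a / wt t k * u| * wt t k := by
        rw [← abs_of_pos (wt_pos t k), ← abs_mul, abs_of_pos (wt_pos t k)]
        congr 1
        field_simp
    _ ≤ A * (D * r / wt s k) * wt t k := hmul
    _ = A * (D * r) / wt (s - t) k := by
        rw [hw]
        field_simp

end Weights

namespace Omega

variable {s t : ℝ}

theorem seq_mk (x : ℕ → ℝ) (hx : MemOmega s x) : (Omega.mk x hx).seq = x := rfl

theorem seq_add (x y : Omega s) : (x + y).seq = x.seq + y.seq := rfl

theorem seq_smul (c : ℝ) (x : Omega s) : (c • x).seq = c • x.seq := rfl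

theorem abs_seq_mul_wt_le (x : Omega s) (k : ℕ) : |x.seq k| * wt s k ≤ ‖x‖ :=
  le_omegaNorm x.mem k

theorem abs_seq_le {x : Omega s} {r : ℝ} (h : ‖x‖ ≤ r) (k : ℕ) : |x.seq k| ≤ r / wt s k :=
  (le_div_iff₀ (wt_pos s k)).2 ((x.abs_seq_mul_wt_le k).trans h)

theorem norm_le {x : Omega s} {C : ℝ} (h : ∀ k, |x.seq k| ≤ C / wt s k) : ‖x‖ ≤ C :=
  ciSup_le fun k => (le_div_iff₀ (wt_pos s k)).1 (h k)

end Omega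

section MemOmega

variable {s t : ℝ} {x y : ℕ → ℝ}

theorem omegaNorm_nonneg (s : ℝ) (x : ℕ → ℝ) : 0 ≤ omegaNorm s x :=
  Real.iSup_nonneg fun k => mul_nonneg (abs_nonneg _) (wt_pos s k).le

theorem MemOmega.abs_le (hx : MemOmega s x) (k : ℕ) : |x k| ≤ omegaNorm s x / wt s k :=
  (le_div_iff₀ (wt_pos s k)).2 (le_omegaNorm hx k)

theorem memOmega_of_abs_le {C : ℝ} (h : ∀ k, |x k| ≤ C / wt s k) : MemOmega s x :=
  memOmega_iff.2 ⟨C, fun k => (le_div_iff₀ (wt_pos s k)).1 (h k)⟩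

theorem MemOmega.add (hx : MemOmega s x) (hy : MemOmega s y) : MemOmega s (x + y) :=
  (omegaSubmodule s).add_mem hx hy

theorem MemOmega.sub (hx : MemOmega s x) (hy : MemOmega s y) : MemOmega s (x - y) :=
  (omegaSubmodule s).sub_mem hx hy

theorem MemOmega.smul (c : ℝ) (hx : MemOmega s x) : MemOmega s (c • x) :=
  (omegaSubmodule s).smul_mem c hx

theorem MemOmega.of_exponent_le (h : t ≤ s) (hx : MemOmega s x) : MemOmega t x :=
  memOmega_iff.2 ⟨omegaNorm s x, fun k =>
    (mul_le_mul_of_nonneg_left (wt_le_wt_of_exponent_le h k) (abs_nonneg _)).trans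
      (le_omegaNorm hx k)⟩

end MemOmega

/-- A linear map `G` from `Ω^s` to sequences with `‖G x‖_t ≤ C ‖x‖_s`, as a continuous linear map
`Ω^s → Ω^t`. -/
noncomputable def Omega.clm {s t : ℝ} (G : Omega s →ₗ[ℝ] (ℕ → ℝ)) (C : ℝ)
    (h : ∀ x k, |G x k| ≤ C * ‖x‖ / wt t k) : Omega s →L[ℝ] Omega t :=
  LinearMap.mkContinuous
    { toFun := fun x => Omega.mk (G x) (memOmega_of_abs_le (h x))
      map_add' := fun x y => Omega.ext fun k => congrFun (G.map_add x y) k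
      map_smul' := fun c x => Omega.ext fun k => congrFun (G.map_smul c x) k } C
    fun x => Omega.norm_le (h x)

/-- The inclusion of `Ω^s` in `Ω^t` for `t ≤ s`. -/
noncomputable def Omega.incl {s t : ℝ} (h : t ≤ s) : Omega s →L[ℝ] Omega t :=
  Omega.clm
    { toFun := Omega.seq
      map_add' := fun _ _ => rfl
      map_smul' := fun _ _ => rfl } 1 fun x k => by
        rw [one_mul]
        exact (Omega.abs_seq_le le_rfl k).trans (div_le_div_of_nonneg_left (norm_nonneg x)
          (wt_pos t k) (wt_le_wt_of_exponent_le h k))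

/-- The evaluation of a sequence in `Ω^s` at an index. -/
noncomputable def Omega.coord (s : ℝ) (k : ℕ) : Omega s →L[ℝ] ℝ :=
  LinearMap.mkContinuous
    { toFun := fun x => x.seq k
      map_add' := fun _ _ => rfl
      map_smul' := fun _ _ => rfl } (1 / wt s k) fun x => by
        rw [one_div, inv_mul_eq_div]
        exact Omega.abs_seq_le le_rfl k

/-! ### The convolution estimate -/

section HyperharmonicSums

theorem summable_one_div_succ_rpow {s : ℝ} (hs : 1 < s) :
    Summable fun n : ℕ => 1 / ((n : ℝ) + 1) ^ s := by
  simpa using (summable_nat_add_iff 1).2 (Real.summable_one_div_nat_rpow.2 hs)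

theorem sum_range_one_div_add_succ_rpow_le {s x : ℝ} (hs : 1 < s) (hx : 0 < x) (n : ℕ) :
    ∑ i ∈ Finset.range n, 1 / (x + (i + 1 : ℕ)) ^ s ≤ 1 / ((s - 1) * x ^ (s - 1)) := by
  have hanti : AntitoneOn (fun y : ℝ => y ^ (-s)) (Set.Icc x (x + n)) := fun y hy z _ hyz =>
    Real.rpow_le_rpow_of_nonpos (hx.trans_le hy.1) hyz (by linarith)
  have h0 : (0 : ℝ) ∉ Set.uIcc x (x + n) := by
    rw [Set.uIcc_of_le (by simp)]
    exact fun h => hx.not_ge h.1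
  calc ∑ i ∈ Finset.range n, 1 / (x + (i + 1 : ℕ)) ^ s
      = ∑ i ∈ Finset.range n, (x + (i + 1 : ℕ)) ^ (-s) :=
        Finset.sum_congr rfl fun i _ => by rw [Real.rpow_neg (by positivity), one_div]
    _ ≤ ∫ y in x..x + n, y ^ (-s) := hanti.sum_le_integral
    _ = (x ^ (-(s - 1)) - (x + n) ^ (-(s - 1))) / (s - 1) := by
        rw [integral_rpow (Or.inr ⟨by linarith, h0⟩), ← neg_div_neg_eq, neg_sub,
          show -(-s + 1) = s - 1 by ring, show -s + 1 = -(s - 1) by ring]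
    _ ≤ x ^ (-(s - 1)) / (s - 1) :=
        div_le_div_of_nonneg_right (sub_le_self _ (by positivity)) (by linarith)
    _ = 1 / ((s - 1) * x ^ (s - 1)) := by
        rw [Real.rpow_neg hx.le, one_div, mul_inv, div_eq_inv_mul]

theorem tsum_one_div_succ_rpow_le {s : ℝ} (hs : 1 < s) {N : ℕ} (hN : 1 ≤ N) :
    ∑' n : ℕ, 1 / ((n : ℝ) + 1) ^ s
      ≤ ∑ l ∈ Finset.Icc 1 N, 1 / (l : ℝ) ^ s + 1 / ((s - 1) * (N : ℝ) ^ (s - 1)) := by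
  have htail : ∑' n : ℕ, 1 / (((n + N : ℕ) : ℝ) + 1) ^ s ≤ 1 / ((s - 1) * (N : ℝ) ^ (s - 1)) := by
    refine Real.tsum_le_of_sum_range_le (fun n => by positivity) fun n => ?_
    refine (Finset.sum_le_sum fun i _ => le_of_eq ?_).trans
      (sum_range_one_div_add_succ_rpow_le hs (by exact_mod_cast hN) n)
    push_cast
    ring_nf
  rw [← (summable_one_div_succ_rpow hs).sum_add_tsum_nat_add N, ← Finset.Ico_succ_right_eq_Icc,
    Order.succ_eq_add_one, Finset.sum_Ico_eq_sum_range]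
  refine add_le_add (le_of_eq (Finset.sum_congr rfl fun i _ => ?_)) htail
  rw [Nat.cast_add, Nat.cast_one, add_comm]

theorem sum_Icc_two_one_div_le_log {n : ℕ} (hn : 1 ≤ n) :
    ∑ l ∈ Finset.Icc 2 n, 1 / (l : ℝ) ≤ Real.log n := by
  have h := harmonic_le_one_add_log n
  rw [harmonic_eq_sum_Icc, ← Finset.add_sum_Ioc_eq_sum_Icc hn] at h
  push_cast at h
  simp only [inv_one, add_le_add_iff_left] at h
  simp only [one_div]
  exact h

theorem sum_Icc_two_one_div_sq_le (n : ℕ) :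
    ∑ l ∈ Finset.Icc 2 n, 1 / (l : ℝ) ^ 2 ≤ Real.pi ^ 2 / 6 - 1 := by
  have h := hasSum_zeta_two.summable.sum_le_tsum (insert 1 (Finset.Icc 2 n))
    fun i _ => by positivity
  rw [hasSum_zeta_two.tsum_eq, Finset.sum_insert (by simp), Nat.cast_one, one_pow, div_one] at h
  linarith

theorem log_sub_two_div_add_one_le {x : ℝ} (hx : 2 < x) (h : x / (x - 2) ≤ Real.log (x - 2)) :
    Real.log (x + 1 - 2) / (x + 1) ≤ Real.log (x - 2) / x := by
  have hx2 : 0 < x - 2 := sub_pos.2 hx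
  have hfac : x + 1 - 2 = (x - 2) * (1 + 1 / (x - 2)) := by
    field_simp
    ring
  have hlog : Real.log (x + 1 - 2) ≤ Real.log (x - 2) + 1 / (x - 2) := by
    rw [hfac, Real.log_mul hx2.ne' (by positivity)]
    linarith [Real.log_le_sub_one_of_pos (show 0 < 1 + 1 / (x - 2) by positivity)]
  rw [div_le_div_iff₀ (by linarith) (by linarith)]
  calc Real.log (x + 1 - 2) * x ≤ (Real.log (x - 2) + 1 / (x - 2)) * x := by gcongr
    _ = Real.log (x - 2) * x + x / (x - 2) := by ring
    _ ≤ Real.log (x - 2) * (x + 1) := by linarith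

theorem seven_div_five_le_log_five : (7 / 5 : ℝ) ≤ Real.log 5 := by
  have h : Real.exp 1 ^ 7 ≤ (5 : ℝ) ^ 5 := calc
    Real.exp 1 ^ 7 ≤ (2.7182818286 : ℝ) ^ 7 := by
      gcongr
      exact Real.exp_one_lt_d9.le
    _ ≤ 5 ^ 5 := by norm_num
  have hlog := Real.log_le_log (by positivity) h
  rw [Real.log_pow, Real.log_pow, Real.log_exp] at hlog
  push_cast at hlog
  linarith

-- `log (x - 2) / x` still increases at `x = 6`, so the step from `6` to `7` is numerical.
theorem log_sub_two_div_antitoneOn :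
    AntitoneOn (fun k : ℕ => Real.log ((k : ℝ) - 2) / k) (Set.Ici 6) := by
  refine antitoneOn_of_succ_le Set.ordConnected_Ici fun k _ hk _ => ?_
  rw [Nat.succ_eq_succ, Nat.cast_succ]
  rcases (Set.mem_Ici.1 hk).eq_or_lt with rfl | h7
  · have h := Real.log_le_log (by positivity) (show (5 : ℝ) ^ 6 ≤ 4 ^ 7 by norm_num)
    rw [Real.log_pow, Real.log_pow] at h
    push_cast at h
    norm_num
    linarith
  · have h7 : (7 : ℝ) ≤ k := by exact_mod_cast h7
    refine log_sub_two_div_add_one_le (by linarith) ?_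
    calc (k : ℝ) / (k - 2) ≤ 7 / 5 := by
          rw [div_le_div_iff₀ (by linarith) (by norm_num)]
          linarith
      _ ≤ Real.log 5 := seven_div_five_le_log_five
      _ ≤ Real.log (k - 2) := Real.log_le_log (by norm_num) (by linarith)

theorem sum_Icc_reflect {R : Type*} [AddCommMonoid R] (F : ℕ → R) (a k : ℕ) :
    ∑ l ∈ Finset.Icc a (k - a), F (k - l) = ∑ l ∈ Finset.Icc a (k - a), F l := by
  refine Finset.sum_nbij' (fun l => k - l) (fun l => k - l) ?_ ?_ ?_ ?_ ?_ <;>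
    intro l hl <;> simp only [Finset.mem_Icc] at hl ⊢ <;> try omega

theorem sum_Icc_sq_inv_add_inv_eq (k : ℕ) :
    ∑ l ∈ Finset.Icc 2 (k - 2), (1 / (l : ℝ) + 1 / ((k : ℝ) - l)) ^ 2
      = 2 * ∑ l ∈ Finset.Icc 2 (k - 2), 1 / (l : ℝ) ^ 2
        + 4 / (k : ℝ) * ∑ l ∈ Finset.Icc 2 (k - 2), 1 / (l : ℝ) := by
  have hexpand : ∀ l ∈ Finset.Icc 2 (k - 2), (1 / (l : ℝ) + 1 / ((k : ℝ) - l)) ^ 2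
      = 1 / (l : ℝ) ^ 2 + 1 / ((k - l : ℕ) : ℝ) ^ 2
        + 2 / (k : ℝ) * (1 / (l : ℝ) + 1 / ((k - l : ℕ) : ℝ)) := by
    intro l hl
    rw [Finset.mem_Icc] at hl
    have hl0 : (l : ℝ) ≠ 0 := by exact_mod_cast (by omega : l ≠ 0)
    have hk0 : (k : ℝ) ≠ 0 := by exact_mod_cast (by omega : k ≠ 0)
    have hlk : (k : ℝ) - l ≠ 0 := sub_ne_zero.2 (by exact_mod_cast (by omega : k ≠ l))
    rw [Nat.cast_sub (by omega)]
    field_simp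
    ring
  rw [Finset.sum_congr rfl hexpand, Finset.sum_add_distrib, Finset.sum_add_distrib,
    ← Finset.mul_sum, Finset.sum_add_distrib, sum_Icc_reflect fun l => 1 / (l : ℝ) ^ 2,
    sum_Icc_reflect fun l => 1 / (l : ℝ)]
  ring

theorem sum_Icc_sq_inv_add_inv_le {m k : ℕ} (hm : 6 ≤ m) (hk : m ≤ k) :
    ∑ l ∈ Finset.Icc 2 (k - 2), (1 / (l : ℝ) + 1 / ((k : ℝ) - l)) ^ 2
      ≤ 4 * Real.log ((m : ℝ) - 2) / m + (Real.pi ^ 2 - 6) / 3 := by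
  have hharm : ∑ l ∈ Finset.Icc 2 (k - 2), 1 / (l : ℝ) ≤ Real.log ((k : ℝ) - 2) := by
    exact_mod_cast Nat.cast_sub (R := ℝ) (by omega : 2 ≤ k) ▸
      sum_Icc_two_one_div_le_log (by omega : 1 ≤ k - 2)
  have hlog : Real.log ((k : ℝ) - 2) / k ≤ Real.log ((m : ℝ) - 2) / m :=
    log_sub_two_div_antitoneOn hm (hm.trans hk) hk
  calc _ = 2 * ∑ l ∈ Finset.Icc 2 (k - 2), 1 / (l : ℝ) ^ 2
        + 4 / (k : ℝ) * ∑ l ∈ Finset.Icc 2 (k - 2), 1 / (l : ℝ) := sum_Icc_sq_inv_add_inv_eq k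
    _ ≤ 2 * (Real.pi ^ 2 / 6 - 1) + 4 / (k : ℝ) * Real.log ((k : ℝ) - 2) := by
        gcongr
        exact sum_Icc_two_one_div_sq_le _
    _ = 4 * (Real.log ((k : ℝ) - 2) / k) + (Real.pi ^ 2 - 6) / 3 := by ring
    _ ≤ 4 * (Real.log ((m : ℝ) - 2) / m) + (Real.pi ^ 2 - 6) / 3 := by gcongr
    _ = _ := by rw [mul_div_assoc]

theorem div_mul_sub_le {m k l : ℝ} (hm : 4 ≤ m) (hk : m ≤ k) (hl : 2 ≤ l) (hlk : l + 2 ≤ k) :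
    k / (l * (k - l)) ≤ 2 / m + 1 / 2 := by
  have hprod : 2 * (k - 2) ≤ l * (k - l) := by nlinarith
  calc k / (l * (k - l)) ≤ k / (2 * (k - 2)) :=
        div_le_div_of_nonneg_left (by linarith) (by linarith) hprod
    _ = 1 / (k - 2) + 1 / 2 := by
        have : k - 2 ≠ 0 := by linarith
        field_simp
        ring
    _ ≤ 1 / (m / 2) + 1 / 2 := by
        gcongr
        linarith
    _ = 2 / m + 1 / 2 := by rw [one_div_div]

theorem rpow_div_rpow_mul_rpow_le {s m k l : ℝ} (hs : 2 ≤ s) (hm : 4 ≤ m) (hk : m ≤ k)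
    (hl : 2 ≤ l) (hlk : l + 2 ≤ k) :
    k ^ s / (l ^ s * (k - l) ^ s)
      ≤ (1 / l + 1 / (k - l)) ^ 2 * (2 / m + 1 / 2) ^ (s - 2) := by
  have hk0 : 0 < k := by linarith
  have hl0 : 0 < l := by linarith
  have hkl0 : 0 < k - l := by linarith
  have hq0 : 0 < k / (l * (k - l)) := by positivity
  have hsum : k / (l * (k - l)) = 1 / l + 1 / (k - l) := by
    field_simp
    ring
  calc k ^ s / (l ^ s * (k - l) ^ s) = (k / (l * (k - l))) ^ s := by
        rw [← Real.mul_rpow hl0.le hkl0.le, Real.div_rpow hk0.le (by positivity)]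
    _ = (k / (l * (k - l))) ^ 2 * (k / (l * (k - l))) ^ (s - 2) := by
        rw [← Real.rpow_natCast, ← Real.rpow_add hq0, Nat.cast_two, add_sub_cancel]
    _ ≤ (k / (l * (k - l))) ^ 2 * (2 / m + 1 / 2) ^ (s - 2) := by
        gcongr
        exact div_mul_sub_le hm hk hl hlk
    _ = _ := by rw [hsum]

theorem sum_Icc_rpow_div_le {s : ℝ} (hs : 2 ≤ s) {m k : ℕ} (hm : 6 ≤ m) (hk : m ≤ k) :
    ∑ l ∈ Finset.Icc 1 (k - 1), (k : ℝ) ^ s / ((l : ℝ) ^ s * ((k : ℝ) - l) ^ s)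
      ≤ 2 * ((m : ℝ) / ((m : ℝ) - 1)) ^ s
        + (4 * Real.log ((m : ℝ) - 2) / m + (Real.pi ^ 2 - 6) / 3)
          * (2 / (m : ℝ) + 1 / 2) ^ (s - 2) := by
  have hm' : (6 : ℝ) ≤ m := by exact_mod_cast hm
  have hk' : (m : ℝ) ≤ k := by exact_mod_cast hk
  have hset : Finset.Icc 1 (k - 1) = insert 1 (insert (k - 1) (Finset.Icc 2 (k - 2))) := by
    ext l
    simp only [Finset.mem_insert, Finset.mem_Icc]
    omega
  have hend : (k : ℝ) ^ s / ((k : ℝ) - 1) ^ s ≤ ((m : ℝ) / ((m : ℝ) - 1)) ^ s := by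
    rw [← Real.div_rpow (by linarith) (by linarith)]
    refine Real.rpow_le_rpow (div_nonneg (by linarith) (by linarith)) ?_ (by linarith)
    rw [div_le_div_iff₀ (by linarith) (by linarith)]
    linarith
  have hmid : ∑ l ∈ Finset.Icc 2 (k - 2), (k : ℝ) ^ s / ((l : ℝ) ^ s * ((k : ℝ) - l) ^ s)
      ≤ (4 * Real.log ((m : ℝ) - 2) / m + (Real.pi ^ 2 - 6) / 3)
        * (2 / (m : ℝ) + 1 / 2) ^ (s - 2) := by
    refine (Finset.sum_le_sum fun l hl => ?_).trans
      ((Finset.sum_mul _ _ _).symm.trans_le (mul_le_mul_of_nonneg_right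
        (sum_Icc_sq_inv_add_inv_le hm hk) (Real.rpow_nonneg (by positivity) _)))
    rw [Finset.mem_Icc] at hl
    exact rpow_div_rpow_mul_rpow_le hs (by linarith) hk' (by exact_mod_cast hl.1)
      (by exact_mod_cast (by omega : l + 2 ≤ k))
  rw [hset, Finset.sum_insert (by simp; omega), Finset.sum_insert (by simp; omega),
    Nat.cast_sub (by omega), Nat.cast_one, sub_sub_cancel, Real.one_rpow, one_mul, mul_one]
  linarith

end HyperharmonicSums

section Convolution

variable {s : ℝ} {x y : ℕ → ℝ}

theorem conv_eq_sum_range_add_tsum {k : ℕ}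
    (h : Summable fun j : ℤ => x j.natAbs * y ((k : ℤ) - j).natAbs) :
    conv x y k = ∑ l ∈ Finset.range (k + 1), x l * y (k - l)
      + (∑' n : ℕ, x (n + (k + 1)) * y (n + 1) + ∑' n : ℕ, x (n + 1) * y (n + (k + 1))) := by
  set F : ℤ → ℝ := fun j => x j.natAbs * y ((k : ℤ) - j).natAbs with hF
  have hneg : Function.Injective fun n : ℕ => -((n : ℤ) + 1) := fun a b h => by simpa using h
  have hnat : Summable fun n : ℕ => F n := h.comp_injective Nat.cast_injective
  have hlow : ∀ l ∈ Finset.range (k + 1), F l = x l * y (k - l) := fun l hl => by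
    have := Finset.mem_range.1 hl
    simp only [hF, Int.natAbs_natCast, show ((k : ℤ) - (l : ℤ)).natAbs = k - l by omega]
  have hhigh : ∀ n : ℕ, F ((n + (k + 1) : ℕ) : ℤ) = x (n + (k + 1)) * y (n + 1) := fun n => by
    simp only [hF, Int.natAbs_natCast,
      show ((k : ℤ) - ((n + (k + 1) : ℕ) : ℤ)).natAbs = n + 1 by omega]
  have hminus : ∀ n : ℕ, F (-((n : ℤ) + 1)) = x (n + 1) * y (n + (k + 1)) := fun n => by
    simp only [hF, show (-((n : ℤ) + 1)).natAbs = n + 1 by omega,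
      show ((k : ℤ) - -((n : ℤ) + 1)).natAbs = n + (k + 1) by omega]
  rw [conv, tsum_of_nat_of_neg_add_one hnat (h.comp_injective hneg),
    ← hnat.sum_add_tsum_nat_add (k + 1), add_assoc, Finset.sum_congr rfl hlow, tsum_congr hhigh,
    tsum_congr hminus]

theorem summable_inv_wt_natAbs (hs : 1 < s) : Summable fun j : ℤ => (wt s)⁻¹ j.natAbs := by
  have h : Summable fun n => (wt s n)⁻¹ := by
    rw [← summable_nat_add_iff 1]
    simpa only [wt_succ, one_div] using summable_one_div_succ_rpow hs
  refine Summable.of_nat_of_neg ?_ ?_ <;> simpa using h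

theorem summable_inv_wt_conv (hs : 1 < s) (k : ℕ) :
    Summable fun j : ℤ => (wt s)⁻¹ j.natAbs * (wt s)⁻¹ ((k : ℤ) - j).natAbs :=
  Summable.of_nonneg_of_le
    (fun _ => mul_nonneg (inv_nonneg.2 (wt_pos s _).le) (inv_nonneg.2 (wt_pos s _).le))
    (fun _ => mul_le_of_le_one_right (inv_nonneg.2 (wt_pos s _).le)
      (inv_le_one_of_one_le₀ (one_le_wt (by linarith) _)))
    (summable_inv_wt_natAbs hs)

theorem tsum_inv_wt_mul_le (hs : 1 < s) (k : ℕ) :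
    ∑' n : ℕ, (wt s)⁻¹ (n + 1) * (wt s)⁻¹ (n + (k + 1))
      ≤ (∑' n : ℕ, 1 / ((n : ℝ) + 1) ^ s) / wt s k := by
  have hle : ∀ n : ℕ, (wt s)⁻¹ (n + 1) * (wt s)⁻¹ (n + (k + 1))
      ≤ 1 / ((n : ℝ) + 1) ^ s / wt s k := by
    intro n
    rw [Pi.inv_apply, Pi.inv_apply, wt_succ, div_eq_mul_inv, one_div]
    exact mul_le_mul_of_nonneg_left
      (inv_anti₀ (wt_pos s k) (wt_mono (by linarith) (by omega))) (by positivity)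
  rw [← tsum_div_const]
  have hsum := (summable_one_div_succ_rpow hs).div_const (wt s k)
  exact (Summable.of_nonneg_of_le (fun n => mul_nonneg (inv_nonneg.2 (wt_pos s _).le)
    (inv_nonneg.2 (wt_pos s _).le)) hle hsum).tsum_le_tsum hle hsum

theorem sum_range_inv_wt_mul {k : ℕ} (hk : 0 < k) (s : ℝ) :
    ∑ l ∈ Finset.range (k + 1), (wt s)⁻¹ l * (wt s)⁻¹ (k - l)
      = (2 + ∑ l ∈ Finset.Icc 1 (k - 1), (k : ℝ) ^ s / ((l : ℝ) ^ s * ((k : ℝ) - l) ^ s))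
        / wt s k := by
  have hset : Finset.range (k + 1) = insert 0 (insert k (Finset.Icc 1 (k - 1))) := by
    ext l
    simp only [Finset.mem_insert, Finset.mem_Icc, Finset.mem_range]
    omega
  have hmid : ∀ l ∈ Finset.Icc 1 (k - 1), (wt s)⁻¹ l * (wt s)⁻¹ (k - l)
      = (k : ℝ) ^ s / ((l : ℝ) ^ s * ((k : ℝ) - l) ^ s) / wt s k := by
    intro l hl
    rw [Finset.mem_Icc] at hl
    have : (k : ℝ) ^ s ≠ 0 := (Real.rpow_pos_of_pos (by exact_mod_cast hk) s).ne'
    rw [Pi.inv_apply, Pi.inv_apply, wt_of_pos hk, wt_of_pos hl.1, wt_of_pos (by omega : 0 < k - l),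
      Nat.cast_sub (by omega)]
    field_simp
  rw [hset, Finset.sum_insert (by simp; omega), Finset.sum_insert (by simp; omega), add_div,
    Finset.sum_div, Finset.sum_congr rfl hmid, Nat.sub_self, Nat.sub_zero, ← add_assoc]
  simp only [Pi.inv_apply, wt_zero]
  ring

theorem conv_inv_wt_le (hs : 2 ≤ s) {m N : ℕ} (hm : 6 ≤ m) (hN : 1 ≤ N) (k : ℕ) :
    conv (wt s)⁻¹ (wt s)⁻¹ k ≤ alpha s m N k / wt s k := by
  have hs1 : 1 < s := by linarith
  have htail : ∑' n : ℕ, (wt s)⁻¹ (n + (k + 1)) * (wt s)⁻¹ (n + 1)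
        + ∑' n : ℕ, (wt s)⁻¹ (n + 1) * (wt s)⁻¹ (n + (k + 1))
      ≤ (2 * ∑ l ∈ Finset.Icc 1 N, 1 / (l : ℝ) ^ s + 2 / ((s - 1) * (N : ℝ) ^ (s - 1)))
        / wt s k := by
    simp only [mul_comm ((wt s)⁻¹ (_ + (k + 1)))]
    rw [← two_mul]
    refine (mul_le_mul_of_nonneg_left ((tsum_inv_wt_mul_le hs1 k).trans (div_le_div_of_nonneg_right
      (tsum_one_div_succ_rpow_le hs1 hN) (wt_pos s k).le)) zero_le_two).trans_eq ?_
    ring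
  rw [conv_eq_sum_range_add_tsum (summable_inv_wt_conv hs1 k)]
  refine (add_le_add_right htail _).trans ?_
  rcases Nat.eq_zero_or_pos k with rfl | hk
  · simp only [alpha, if_pos, zero_add, Finset.sum_range_one, Nat.sub_self, Pi.inv_apply, wt_zero,
      inv_one, mul_one, div_one, add_assoc, le_refl]
  · rw [sum_range_inv_wt_mul hk, ← add_div]
    refine div_le_div_of_nonneg_right ?_ (wt_pos s k).le
    rw [alpha, if_neg hk.ne']
    split_ifs with hkm
    · linarith
    · linarith [sum_Icc_rpow_div_le hs hm (not_lt.1 hkm)]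

theorem alpha_of_le {m N k : ℕ} (hm : 0 < m) (hk : m ≤ k) : alpha s m N k = alpha s m N m := by
  rw [alpha, alpha, if_neg (by omega), if_neg (by omega), if_neg hm.ne', if_neg (lt_irrefl m)]

theorem bddAbove_range_alpha (s : ℝ) {m : ℕ} (N : ℕ) (hm : 0 < m) :
    BddAbove (Set.range (alpha s m N)) := by
  refine ((Finset.range (m + 1)).image (alpha s m N)).bddAbove.mono ?_
  rintro _ ⟨k, rfl⟩
  refine Finset.mem_coe.2 (Finset.mem_image.2 ⟨min k m, Finset.mem_range.2 (by omega), ?_⟩)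
  rcases le_total k m with h | h
  · rw [min_eq_left h]
  · rw [min_eq_right h, alpha_of_le hm h]

theorem abs_conv_term_le {X Y : ℝ} (hx : ∀ k, |x k| ≤ X / wt s k) (hy : ∀ k, |y k| ≤ Y / wt s k)
    (k : ℕ) (j : ℤ) :
    |x j.natAbs * y ((k : ℤ) - j).natAbs|
      ≤ X * Y * ((wt s)⁻¹ j.natAbs * (wt s)⁻¹ ((k : ℤ) - j).natAbs) := by
  rw [abs_mul, mul_mul_mul_comm]
  exact mul_le_mul (hx _) (hy _) (abs_nonneg _) ((abs_nonneg _).trans (hx _))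

theorem summable_conv (hs : 1 < s) (hx : MemOmega s x) (hy : MemOmega s y) (k : ℕ) :
    Summable fun j : ℤ => x j.natAbs * y ((k : ℤ) - j).natAbs :=
  Summable.of_norm_bounded ((summable_inv_wt_conv hs k).mul_left _)
    (abs_conv_term_le hx.abs_le hy.abs_le k)

theorem abs_conv_le (hs : 2 ≤ s) {m N : ℕ} (hm : 6 ≤ m) (hN : 1 ≤ N) {X Y : ℝ}
    (hx : ∀ k, |x k| ≤ X / wt s k) (hy : ∀ k, |y k| ≤ Y / wt s k) (k : ℕ) :
    |conv x y k| ≤ alpha s m N k * (X * Y) / wt s k := by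
  have hX : 0 ≤ X := by simpa [wt_zero] using (abs_nonneg _).trans (hx 0)
  have hY : 0 ≤ Y := by simpa [wt_zero] using (abs_nonneg _).trans (hy 0)
  have hs1 : 1 < s := by linarith
  calc |conv x y k| ≤ ∑' j : ℤ, X * Y * ((wt s)⁻¹ j.natAbs * (wt s)⁻¹ ((k : ℤ) - j).natAbs) :=
        tsum_of_norm_bounded (f := fun j : ℤ => x j.natAbs * y ((k : ℤ) - j).natAbs)
          ((summable_inv_wt_conv hs1 k).mul_left _).hasSum (abs_conv_term_le hx hy k)
    _ = X * Y * conv (wt s)⁻¹ (wt s)⁻¹ k := tsum_mul_left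
    _ ≤ X * Y * (alpha s m N k / wt s k) := by
        gcongr
        exact conv_inv_wt_le hs hm hN k
    _ = _ := by ring

theorem conv_comm (x y : ℕ → ℝ) : conv x y = conv y x := by
  funext k
  rw [conv, ← (Equiv.subLeft (k : ℤ)).tsum_eq]
  simp only [Equiv.subLeft_apply, sub_sub_cancel, mul_comm, conv]

theorem conv_add_left (hs : 1 < s) {x' : ℕ → ℝ} (hx : MemOmega s x) (hx' : MemOmega s x')
    (hy : MemOmega s y) : conv (x + x') y = conv x y + conv x' y := by
  funext k
  simp only [conv, Pi.add_apply, add_mul]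
  exact (summable_conv hs hx hy k).tsum_add (summable_conv hs hx' hy k)

theorem conv_add_right (hs : 1 < s) {y' : ℕ → ℝ} (hx : MemOmega s x) (hy : MemOmega s y)
    (hy' : MemOmega s y') : conv x (y + y') = conv x y + conv x y' := by
  rw [conv_comm, conv_add_left hs hy hy' hx, conv_comm y, conv_comm y']

theorem conv_smul_left (c : ℝ) (x y : ℕ → ℝ) : conv (c • x) y = c • conv x y := by
  funext k
  simp only [conv, Pi.smul_apply, smul_eq_mul, mul_assoc]
  exact tsum_mul_left

theorem conv_smul_right (c : ℝ) (x y : ℕ → ℝ) : conv x (c • y) = c • conv x y := by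
  rw [conv_comm, conv_smul_left, conv_comm y]

theorem exists_abs_conv_le (hs : 2 ≤ s) : ∃ C, ∀ x y : Omega s, ∀ k,
    |conv x.seq y.seq k| ≤ C * ‖x‖ * ‖y‖ / wt s k := by
  obtain ⟨C, hC⟩ := bddAbove_range_alpha s (m := 6) 1 (by norm_num)
  refine ⟨C, fun x y k => ?_⟩
  rw [mul_assoc]
  refine (abs_conv_le hs le_rfl le_rfl (Omega.abs_seq_le le_rfl) (Omega.abs_seq_le le_rfl) k).trans
    (div_le_div_of_nonneg_right ?_ (wt_pos s k).le)
  gcongr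
  exact hC ⟨k, rfl⟩

theorem memOmega_conv (hs : 2 ≤ s) (x y : Omega s) : MemOmega s (conv x.seq y.seq) :=
  let ⟨_, hC⟩ := exists_abs_conv_le hs
  memOmega_of_abs_le (hC x y)

/-- The convolution as a continuous bilinear map on `Ω^s`. -/
noncomputable def convL (hs : 2 ≤ s) : Omega s →L[ℝ] Omega s →L[ℝ] Omega s :=
  LinearMap.mkContinuous₂
    (LinearMap.mk₂ ℝ (fun x y => Omega.mk (conv x.seq y.seq) (memOmega_conv hs x y))
      (fun x x' y => Omega.ext <| congrFun <| conv_add_left (by linarith) x.mem x'.mem y.mem)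
      (fun c x y => Omega.ext <| congrFun <| conv_smul_left c x.seq y.seq)
      (fun x y y' => Omega.ext <| congrFun <| conv_add_right (by linarith) x.mem y.mem y'.mem)
      (fun c x y => Omega.ext <| congrFun <| conv_smul_right c x.seq y.seq))
    (exists_abs_conv_le hs).choose
    fun x y => Omega.norm_le ((exists_abs_conv_le hs).choose_spec x y)

theorem convL_flip (hs : 2 ≤ s) : (convL hs).flip = convL hs := by
  ext x y
  exact Omega.ext (congrFun (conv_comm y.seq x.seq))

end Convolution

section GeomConv

/-- The convolution `∑_{j ≤ n} θ^{n-j} Y_j` of a sequence with the powers of `θ`, which solves the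
recursion of forward elimination. -/
noncomputable def geomConv (θ : ℝ) (Y : ℕ → ℝ) (n : ℕ) : ℝ :=
  ∑ j ∈ Finset.range (n + 1), θ ^ (n - j) * Y j

variable {θ : ℝ} {Y : ℕ → ℝ}

theorem geomConv_zero (θ : ℝ) (Y : ℕ → ℝ) : geomConv θ Y 0 = Y 0 := by simp [geomConv]

theorem geomConv_succ (θ : ℝ) (Y : ℕ → ℝ) (n : ℕ) :
    geomConv θ Y (n + 1) = θ * geomConv θ Y n + Y (n + 1) := by
  rw [geomConv, geomConv, Finset.sum_range_succ, Finset.mul_sum, Nat.sub_self, pow_zero, one_mul]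
  congr 1
  refine Finset.sum_congr rfl fun j hj => ?_
  rw [Nat.sub_add_comm (Finset.mem_range_succ_iff.1 hj), pow_succ']
  ring

theorem geomConv_nonneg (hθ : 0 ≤ θ) (hY : ∀ n, 0 ≤ Y n) (n : ℕ) : 0 ≤ geomConv θ Y n :=
  Finset.sum_nonneg fun j _ => mul_nonneg (pow_nonneg hθ _) (hY j)

theorem geomConv_le {B : ℝ} (hθ : 0 ≤ θ) (hθ1 : θ < 1) (hB : 0 ≤ B) (hY : ∀ n, Y n ≤ B) (n : ℕ) :
    geomConv θ Y n ≤ B / (1 - θ) := by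
  have h1 : 0 < 1 - θ := sub_pos.2 hθ1
  have hfix : θ * (B / (1 - θ)) + B = B / (1 - θ) := by field_simp; ring
  induction n with
  | zero =>
    rw [geomConv_zero, ← hfix]
    exact (hY 0).trans (le_add_of_nonneg_left (by positivity))
  | succ n ih =>
    rw [geomConv_succ, ← hfix]
    exact add_le_add (mul_le_mul_of_nonneg_left ih hθ) (hY _)

theorem geomConv_single (θ r : ℝ) (n : ℕ) : geomConv θ (Pi.single 0 r) n = θ ^ n * r := by
  induction n with
  | zero => rw [geomConv_zero, Pi.single_eq_same, pow_zero, one_mul]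
  | succ n ih =>
    rw [geomConv_succ, ih, Pi.single_eq_of_ne n.succ_ne_zero, pow_succ]
    ring

end GeomConv

/-! ### Diagonal dominance of the tail -/

namespace Data

variable (P : Data)

/-- The tail of the tridiagonal operator is row diagonally dominant, with ratio `δ < 1/2` on either
side of the diagonal. -/
structure TailDominant : Prop where
  delta_pos : 0 < P.delta
  delta_lt : P.delta < 1 / 2
  b_ne_zero : ∀ n, P.b (n + 1) ≠ 0
  abs_a_le : ∀ n, |P.a (n + 1)| ≤ P.delta * |P.b (n + 1)|
  abs_c_le : ∀ n, |P.c (n + 1)| ≤ P.delta * |P.b (n + 1)|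

variable {P}

namespace Assumptions

variable {C2 : ℝ} {k0 k : ℕ} (hA : P.Assumptions C2 k0)
include hA

theorem mul_wt_le_abs_mu (hk : k0 ≤ k) : P.C1 * wt P.sL k ≤ |P.mu k| := by
  have h := hA.le_mu k hk
  rwa [abs_div, abs_of_pos (wt_pos _ _), le_div_iff₀ (wt_pos _ _)] at h

theorem mu_ne_zero (hk : k0 ≤ k) : P.mu k ≠ 0 :=
  abs_pos.1 ((mul_pos hA.C1_pos (wt_pos _ _)).trans_le (hA.mul_wt_le_abs_mu hk))

theorem tailDominant (hk0 : k0 ≤ P.m) : P.TailDominant where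
  delta_pos := hA.delta_pos
  delta_lt := hA.delta_lt
  b_ne_zero n := hA.mu_ne_zero (by omega)
  abs_a_le n := by
    have hk : k0 ≤ P.m + (n + 1) - 1 := by omega
    have h := hA.lam_ratio _ hk
    rwa [abs_div, div_le_iff₀ (abs_pos.2 (hA.mu_ne_zero hk))] at h
  abs_c_le n := by
    have hk : k0 ≤ P.m + (n + 1) - 1 := by omega
    have h := hA.beta_ratio _ hk
    rwa [abs_div, div_le_iff₀ (abs_pos.2 (hA.mu_ne_zero hk))] at h

end Assumptions

theorem gamma_pos (P : Data) : 0 < P.gamma := by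
  unfold gamma
  positivity

theorem theta_mul_gamma (P : Data) : P.theta * P.gamma = P.delta :=
  div_mul_cancel₀ _ P.gamma_pos.ne'

variable (P) in
/-- The pivots `δ_{n+1} / δ_n` of the elimination. -/
noncomputable def piv (n : ℕ) : ℝ := P.dlt (n + 1) / P.dlt n

theorem piv_zero (P : Data) : P.piv 0 = P.b 1 := div_one _

namespace TailDominant

variable (H : P.TailDominant)
include H

theorem gamma_sq : P.gamma ^ 2 = P.gamma - P.delta ^ 2 := by
  have h : 0 ≤ 1 / 4 - P.delta ^ 2 := by nlinarith [H.delta_pos, H.delta_lt]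
  unfold gamma
  linear_combination Real.sq_sqrt h

theorem delta_mul_theta : P.delta * P.theta = 1 - P.gamma := by
  have hg := P.gamma_pos.ne'
  have hsq := H.gamma_sq
  unfold theta
  field_simp
  linarith

theorem delta_lt_gamma : P.delta < P.gamma := by
  have := Real.sqrt_nonneg (1 / 4 - P.delta ^ 2)
  have := H.delta_lt
  unfold gamma
  linarith

theorem theta_pos : 0 < P.theta := div_pos H.delta_pos P.gamma_pos

theorem theta_lt_one : P.theta < 1 := (div_lt_one P.gamma_pos).2 H.delta_lt_gamma

theorem gamma_le_one : P.gamma ≤ 1 := by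
  linarith [H.delta_mul_theta, mul_pos H.delta_pos H.theta_pos]

theorem one_sub_theta_sq_pos : 0 < 1 - P.theta ^ 2 :=
  sub_pos.2 (pow_lt_one₀ H.theta_pos.le H.theta_lt_one two_ne_zero)

theorem eta_pos : 0 < P.eta := one_div_pos.2 (mul_pos P.gamma_pos H.one_sub_theta_sq_pos)

theorem abs_div_le_theta {x p : ℝ} {n : ℕ} (hx : |x| ≤ P.delta * |P.b (n + 1)|)
    (hp : P.gamma * |P.b (n + 1)| ≤ |p|) : |x / p| ≤ P.theta := by
  rw [abs_div]
  refine div_le_of_le_mul₀ (abs_nonneg _) H.theta_pos.le (hx.trans ?_)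
  rw [← P.theta_mul_gamma, mul_assoc]
  exact mul_le_mul_of_nonneg_left hp H.theta_pos.le

theorem gamma_mul_le_abs_sub_mul {n : ℕ} {u : ℝ} (hu : |u| ≤ P.theta) :
    P.gamma * |P.b (n + 1)| ≤ |P.b (n + 1) - P.a (n + 1) * u| :=
  calc P.gamma * |P.b (n + 1)| = |P.b (n + 1)| - P.delta * |P.b (n + 1)| * P.theta := by
        linear_combination |P.b (n + 1)| * H.delta_mul_theta
    _ ≤ |P.b (n + 1)| - |P.a (n + 1) * u| := by
        exact sub_le_sub_left (abs_mul_le_of_le (H.abs_a_le n) hu) _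
    _ ≤ _ := abs_sub_abs_le_abs_sub _ _

theorem dlt_ne_zero_and_le_abs_piv (n : ℕ) :
    P.dlt n ≠ 0 ∧ P.dlt (n + 1) ≠ 0 ∧ P.gamma * |P.b (n + 1)| ≤ |P.piv n| := by
  induction n with
  | zero =>
    refine ⟨one_ne_zero, H.b_ne_zero 0, ?_⟩
    rw [piv_zero]
    exact mul_le_of_le_one_left (abs_nonneg _) H.gamma_le_one
  | succ n ih =>
    obtain ⟨_, h1, hle⟩ := ih
    have hpiv : P.piv (n + 1) = P.b (n + 2) - P.a (n + 2) * (P.c (n + 1) / P.piv n) := by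
      simp only [piv, dlt]
      field_simp
    have hle' : P.gamma * |P.b (n + 2)| ≤ |P.piv (n + 1)| :=
      hpiv ▸ H.gamma_mul_le_abs_sub_mul (H.abs_div_le_theta (H.abs_c_le n) hle)
    refine ⟨h1, fun h => ?_, hle'⟩
    rw [piv, h, zero_div, abs_zero] at hle'
    exact hle'.not_gt (mul_pos P.gamma_pos (abs_pos.2 (H.b_ne_zero (n + 1))))

theorem dlt_ne_zero (n : ℕ) : P.dlt n ≠ 0 := (H.dlt_ne_zero_and_le_abs_piv n).1

theorem gamma_mul_le_abs_piv (n : ℕ) : P.gamma * |P.b (n + 1)| ≤ |P.piv n| :=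
  (H.dlt_ne_zero_and_le_abs_piv n).2.2

theorem piv_ne_zero (n : ℕ) : P.piv n ≠ 0 := div_ne_zero (H.dlt_ne_zero _) (H.dlt_ne_zero _)

theorem piv_succ (n : ℕ) :
    P.piv (n + 1) = P.b (n + 2) - P.a (n + 2) * P.c (n + 1) / P.piv n := by
  have := H.dlt_ne_zero (n + 1)
  simp only [piv, dlt]
  field_simp

theorem abs_c_div_piv_le (n : ℕ) : |P.c (n + 1) / P.piv n| ≤ P.theta :=
  H.abs_div_le_theta (H.abs_c_le n) (H.gamma_mul_le_abs_piv n)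

theorem abs_a_div_piv_le (n : ℕ) : |P.a (n + 1) / P.piv n| ≤ P.theta :=
  H.abs_div_le_theta (H.abs_a_le n) (H.gamma_mul_le_abs_piv n)

end TailDominant

/-! ### The lower triangular factor -/

theorem LIinv_zero (P : Data) (y : ℕ → ℝ) : P.LIinv y 0 = y 0 := by simp [LIinv]

theorem LIinv_add (P : Data) (y z : ℕ → ℝ) : P.LIinv (y + z) = P.LIinv y + P.LIinv z := by
  funext k
  simp only [LIinv, Pi.add_apply, mul_add, Finset.sum_add_distrib]
  ring

theorem LIinv_smul (P : Data) (r : ℝ) (y : ℕ → ℝ) : P.LIinv (r • y) = r • P.LIinv y := by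
  funext k
  simp only [LIinv, Pi.smul_apply, smul_eq_mul, mul_add, Finset.mul_sum, mul_left_comm r]

namespace TailDominant

variable (H : P.TailDominant)
include H

theorem LIinv_succ (y : ℕ → ℝ) (n : ℕ) :
    P.LIinv y (n + 1) = y (n + 1) - P.a (n + 2) / P.piv n * P.LIinv y n := by
  have h0 := H.dlt_ne_zero n
  have h1 := H.dlt_ne_zero (n + 1)
  have hset : Finset.Icc 1 (n + 1) = insert 1 ((Finset.Icc 1 n).map (addRightEmbedding 1)) := by
    ext l
    simp only [Finset.map_add_right_Icc, Finset.mem_insert, Finset.mem_Icc]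
    omega
  unfold LIinv
  rw [hset, Finset.sum_insert (by simp), Finset.sum_map, mul_add, Finset.mul_sum, sub_eq_add_neg,
    neg_add, ← Finset.sum_neg_distrib]
  congr 2
  · simp only [Nat.add_sub_cancel, Finset.Icc_self, Finset.prod_singleton, pow_one, piv]
    field_simp
  · refine Finset.sum_congr rfl fun l hl => ?_
    have := (Finset.mem_Icc.1 hl).2
    simp only [addRightEmbedding_apply, Nat.add_sub_add_right]
    rw [Finset.prod_Icc_succ_top (by omega : n - l + 2 ≤ n + 1 + 1)]
    simp only [piv, pow_succ]
    field_simp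

theorem abs_LIinv_div_piv_le {y Y : ℕ → ℝ} (hy : ∀ n, |y n / P.piv n| ≤ Y n) (n : ℕ) :
    |P.LIinv y n / P.piv n| ≤ geomConv P.theta Y n := by
  induction n with
  | zero =>
    rw [LIinv_zero, geomConv_zero]
    exact hy 0
  | succ n ih =>
    have hrec : P.LIinv y (n + 1) / P.piv (n + 1)
        = y (n + 1) / P.piv (n + 1) - P.a (n + 2) / P.piv (n + 1) * (P.LIinv y n / P.piv n) := by
      rw [H.LIinv_succ]
      ring
    rw [hrec, geomConv_succ, add_comm (P.theta * _)]
    exact (abs_sub _ _).trans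
      (add_le_add (hy (n + 1)) (abs_mul_le_of_le (H.abs_a_div_piv_le (n + 1)) ih))

end TailDominant

end Data

/-! ### The upper triangular factor -/

theorem summable_mul_of_abs_le_pow {θ B : ℝ} (hθ : 0 ≤ θ) (hθ1 : θ < 1) {u x : ℕ → ℝ}
    (hu : ∀ l, |u l| ≤ θ ^ l) (hx : ∀ l, |x l| ≤ B) : Summable fun l => u l * x l :=
  Summable.of_norm_bounded ((summable_geometric_of_lt_one hθ hθ1).mul_right B)
    fun l => abs_mul_le_of_le (hu l) (hx l)

namespace Data

variable (P : Data)

/-- The product of the ratios `-c_i δ_{i-1} / δ_i` for `k < i ≤ k + l`. -/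
noncomputable def upCoef (k l : ℕ) : ℝ :=
  (-1) ^ l * (P.dlt k / P.dlt (k + l)) * ∏ i ∈ Finset.Icc (k + 1) (k + l), P.c i

variable {P}

namespace TailDominant

variable (H : P.TailDominant)
include H

theorem upCoef_zero (k : ℕ) : P.upCoef k 0 = 1 := by
  simp [upCoef, H.dlt_ne_zero k]

theorem upCoef_succ (k l : ℕ) :
    P.upCoef k (l + 1) = -(P.c (k + l + 1) / P.piv (k + l)) * P.upCoef k l := by
  have := H.dlt_ne_zero (k + l)
  rw [upCoef, upCoef, ← add_assoc, Finset.prod_Icc_succ_top (by omega), pow_succ, piv]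
  field_simp

theorem abs_upCoef_le (k l : ℕ) : |P.upCoef k l| ≤ P.theta ^ l := by
  induction l with
  | zero => rw [H.upCoef_zero, abs_one, pow_zero]
  | succ l ih =>
    rw [H.upCoef_succ, pow_succ']
    exact abs_mul_le_of_le ((abs_neg _).trans_le (H.abs_c_div_piv_le _)) ih

theorem summable_upCoef_mul {x : ℕ → ℝ} {B : ℝ} (hx : ∀ n, |x n| ≤ B) (k : ℕ) :
    Summable fun l => P.upCoef k l * x (k + l) :=
  summable_mul_of_abs_le_pow H.theta_pos.le H.theta_lt_one (H.abs_upCoef_le k) fun _ => hx _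

theorem UIinv_eq_tsum {z : ℕ → ℝ} {B : ℝ} (hz : ∀ n, |z n / P.piv n| ≤ B) (k : ℕ) :
    P.UIinv z k = ∑' l, P.upCoef k l * (z (k + l) / P.piv (k + l)) := by
  rw [(H.summable_upCoef_mul hz k).tsum_eq_zero_add, H.upCoef_zero, UIinv]
  congr 1
  · rw [piv, add_zero, one_mul, div_div_eq_mul_div, div_mul_eq_mul_div, mul_comm]
  · refine tsum_congr fun l => ?_
    have := H.dlt_ne_zero (k + (l + 1))
    have := H.dlt_ne_zero (k + (l + 1) + 1)
    simp only [upCoef, piv]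
    field_simp

theorem UIinv_mul_add {z : ℕ → ℝ} {B : ℝ} (hz : ∀ n, |z n| ≤ B) (k : ℕ) :
    P.UIinv (fun n => P.piv n * z n + P.c (n + 1) * z (n + 1)) k = z k := by
  have hdiv : ∀ n, (P.piv n * z n + P.c (n + 1) * z (n + 1)) / P.piv n
      = z n + P.c (n + 1) / P.piv n * z (n + 1) := by
    intro n
    have := H.piv_ne_zero n
    field_simp
  have hbd : ∀ n, |(P.piv n * z n + P.c (n + 1) * z (n + 1)) / P.piv n| ≤ B + P.theta * B := by
    intro n
    rw [hdiv]
    exact (abs_add_le _ _).trans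
      (add_le_add (hz n) (abs_mul_le_of_le (H.abs_c_div_piv_le n) (hz _)))
  have htelescope : ∀ l, P.upCoef k l
        * ((P.piv (k + l) * z (k + l) + P.c (k + l + 1) * z (k + l + 1)) / P.piv (k + l))
      = P.upCoef k l * z (k + l) - P.upCoef k (l + 1) * z (k + (l + 1)) := by
    intro l
    rw [hdiv, H.upCoef_succ, ← add_assoc]
    ring
  have hsum := H.summable_upCoef_mul hz k
  rw [H.UIinv_eq_tsum hbd, tsum_congr htelescope, hsum.tsum_sub ((summable_nat_add_iff 1).2 hsum),
    hsum.tsum_eq_zero_add, add_sub_cancel_right, H.upCoef_zero, one_mul, add_zero]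

/-! ### The inverse of the tail -/

theorem tailInv_tridiag {y z : ℕ → ℝ} {B : ℝ} (hz : ∀ n, |z n| ≤ B)
    (hzero : y 0 = P.b 1 * z 0 + P.c 1 * z 1)
    (hsucc : ∀ n, y (n + 1)
      = P.a (n + 2) * z n + P.b (n + 2) * z (n + 1) + P.c (n + 2) * z (n + 2)) :
    P.tailInv y = z := by
  have hL : P.LIinv y = fun n => P.piv n * z n + P.c (n + 1) * z (n + 1) := by
    funext n
    induction n with
    | zero => rw [LIinv_zero, hzero, piv_zero]
    | succ n ih =>
      have := H.piv_ne_zero n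
      rw [H.LIinv_succ, hsucc, ih, H.piv_succ]
      field_simp
      ring
  rw [tailInv, hL]
  exact funext (H.UIinv_mul_add hz)

theorem abs_LIinv_div_piv_le_of_le {y : ℕ → ℝ} {B : ℝ} (hy : ∀ n, |y n / P.piv n| ≤ B) (n : ℕ) :
    |P.LIinv y n / P.piv n| ≤ B / (1 - P.theta) :=
  (H.abs_LIinv_div_piv_le hy n).trans (geomConv_le H.theta_pos.le H.theta_lt_one
    ((abs_nonneg _).trans (hy 0)) (fun _ => le_rfl) n)

theorem hasSum_tailInv {y : ℕ → ℝ} {B : ℝ} (hy : ∀ n, |y n / P.piv n| ≤ B) (k : ℕ) :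
    HasSum (fun l => P.upCoef k l * (P.LIinv y (k + l) / P.piv (k + l))) (P.tailInv y k) := by
  have hbd := H.abs_LIinv_div_piv_le_of_le hy
  rw [tailInv, H.UIinv_eq_tsum hbd]
  exact (H.summable_upCoef_mul hbd k).hasSum

theorem tailInv_add {y z : ℕ → ℝ} {B C : ℝ} (hy : ∀ n, |y n / P.piv n| ≤ B)
    (hz : ∀ n, |z n / P.piv n| ≤ C) : P.tailInv (y + z) = P.tailInv y + P.tailInv z := by
  have hyz : ∀ n, |(y + z) n / P.piv n| ≤ B + C := fun n => by
    rw [Pi.add_apply, add_div]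
    exact (abs_add_le _ _).trans (add_le_add (hy n) (hz n))
  funext k
  refine (H.hasSum_tailInv hyz k).unique ?_
  simpa only [LIinv_add, Pi.add_apply, add_div, mul_add] using
    (H.hasSum_tailInv hy k).add (H.hasSum_tailInv hz k)

theorem tailInv_smul {y : ℕ → ℝ} {B : ℝ} (r : ℝ) (hy : ∀ n, |y n / P.piv n| ≤ B) :
    P.tailInv (r • y) = r • P.tailInv y := by
  have hry : ∀ n, |(r • y) n / P.piv n| ≤ |r| * B := fun n => by
    rw [Pi.smul_apply, smul_eq_mul, mul_div_assoc]
    exact abs_mul_le_of_le le_rfl (hy n)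
  funext k
  refine (H.hasSum_tailInv hry k).unique ?_
  simpa only [LIinv_smul, Pi.smul_apply, smul_eq_mul, mul_div_assoc, mul_left_comm r] using
    (H.hasSum_tailInv hy k).mul_left r

theorem abs_tailInv_le {y Y : ℕ → ℝ} {B : ℝ} (hy : ∀ n, |y n / P.piv n| ≤ Y n)
    (hB : ∀ n, Y n ≤ B) (k : ℕ) :
    |P.tailInv y k| ≤ (geomConv P.theta Y k + ∑' l, P.theta ^ (l + 1) * Y (k + (l + 1)))
      / (1 - P.theta ^ 2) := by
  have hθ := H.theta_pos.le
  have hY : ∀ n, 0 ≤ Y n := fun n => (abs_nonneg _).trans (hy n)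
  have hθpow : ∀ l, |P.theta ^ l| ≤ P.theta ^ l := fun l => (abs_of_nonneg (pow_nonneg hθ l)).le
  have hconv : ∀ l, |geomConv P.theta Y (k + l)| ≤ B / (1 - P.theta) := fun l => by
    rw [abs_of_nonneg (geomConv_nonneg hθ hY _)]
    exact geomConv_le hθ H.theta_lt_one ((hY 0).trans (hB 0)) hB _
  have hsum := summable_mul_of_abs_le_pow hθ H.theta_lt_one hθpow hconv
  have hsumY := (summable_nat_add_iff 1).2 <| summable_mul_of_abs_le_pow hθ H.theta_lt_one hθpow
    fun l => (abs_of_nonneg (hY (k + l))).trans_le (hB _)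
  have hle : |P.tailInv y k| ≤ ∑' l, P.theta ^ l * geomConv P.theta Y (k + l) := by
    rw [← (H.hasSum_tailInv (fun n => (hy n).trans (hB n)) k).tsum_eq, ← Real.norm_eq_abs]
    refine tsum_of_norm_bounded hsum.hasSum fun l => ?_
    exact abs_mul_le_of_le (H.abs_upCoef_le k l) (H.abs_LIinv_div_piv_le hy _)
  have hrec : ∑' l, P.theta ^ l * geomConv P.theta Y (k + l)
      = geomConv P.theta Y k + (P.theta ^ 2 * ∑' l, P.theta ^ l * geomConv P.theta Y (k + l)
        + ∑' l, P.theta ^ (l + 1) * Y (k + (l + 1))) := by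
    rw [← tsum_mul_left, ← (hsum.mul_left (P.theta ^ 2)).tsum_add hsumY, hsum.tsum_eq_zero_add,
      pow_zero, one_mul, add_zero]
    congr 1
    refine tsum_congr fun l => ?_
    rw [← add_assoc, geomConv_succ]
    ring
  rw [le_div_iff₀ H.one_sub_theta_sq_pos]
  linarith [mul_le_mul_of_nonneg_right hle H.one_sub_theta_sq_pos.le]

end TailDominant

/-! ### The first column of the tail inverse -/

theorem abs_single_div_piv_le (P : Data) (n : ℕ) :
    |(Pi.single 0 1 : ℕ → ℝ) n / P.piv n| ≤ (Pi.single 0 (1 / |P.b 1|) : ℕ → ℝ) n := by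
  cases n with
  | zero => simp [piv_zero]
  | succ n => simp

theorem single_inv_le (P : Data) (n : ℕ) :
    (Pi.single 0 (1 / |P.b 1|) : ℕ → ℝ) n ≤ 1 / |P.b 1| := by
  cases n with
  | zero => simp
  | succ n => simp

variable (P) in
/-- The terms of the series of `w_0`, of which `w̃` is a partial sum. -/
noncomputable def wTerm (l : ℕ) : ℝ :=
  P.dlt 0 ^ 2 / (P.dlt l * P.dlt (l + 1))
    * (∏ i ∈ Finset.Icc 1 l, P.c i) * ∏ i ∈ Finset.Icc 2 (l + 1), P.a i

theorem wtilde_eq_sum (P : Data) : P.wtilde = ∑ l ∈ Finset.range (max P.L 1), P.wTerm l := by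
  have hzero : P.wTerm 0 = P.dlt 0 / P.dlt 1 := by simp [wTerm, dlt]
  rw [Finset.range_eq_Ico, Finset.sum_eq_sum_Ico_succ_bot (by omega), hzero, wtilde]
  congr 1
  refine Finset.sum_congr ?_ fun _ _ => rfl
  ext l
  simp only [Finset.mem_Ico]
  omega

namespace TailDominant

variable (H : P.TailDominant)
include H

theorem abs_w_le (k : ℕ) : |P.w k| ≤ P.eta * P.theta ^ k / |P.b 1| := by
  have hη : 1 / (1 - P.theta ^ 2) ≤ P.eta :=
    one_div_le_one_div_of_le (mul_pos P.gamma_pos H.one_sub_theta_sq_pos)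
      (mul_le_of_le_one_left H.one_sub_theta_sq_pos.le H.gamma_le_one)
  have hvanish : ∀ l,
      P.theta ^ (l + 1) * (Pi.single 0 (1 / |P.b 1|) : ℕ → ℝ) (k + (l + 1)) = 0 :=
    fun l => by rw [Pi.single_eq_of_ne (by omega), mul_zero]
  calc |P.w k| ≤ P.theta ^ k * (1 / |P.b 1|) / (1 - P.theta ^ 2) := by
        have h := H.abs_tailInv_le P.abs_single_div_piv_le P.single_inv_le k
        rwa [tsum_congr hvanish, tsum_zero, add_zero, geomConv_single] at h
    _ = 1 / (1 - P.theta ^ 2) * (P.theta ^ k / |P.b 1|) := by ring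
    _ ≤ P.eta * (P.theta ^ k / |P.b 1|) :=
        mul_le_mul_of_nonneg_right hη (div_nonneg (pow_nonneg H.theta_pos.le k) (abs_nonneg _))
    _ = _ := by ring

theorem LIinv_single (n : ℕ) :
    P.LIinv (Pi.single 0 1) n
      = (-1) ^ n * (∏ i ∈ Finset.Icc 2 (n + 1), P.a i) * (P.dlt 0 / P.dlt n) := by
  induction n with
  | zero => simp [LIinv_zero, dlt]
  | succ n ih =>
    have := H.dlt_ne_zero n
    rw [H.LIinv_succ, ih, Pi.single_eq_of_ne n.succ_ne_zero,
      Finset.prod_Icc_succ_top (by omega : 2 ≤ n + 1 + 1), pow_succ, piv]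
    field_simp
    ring

theorem upCoef_mul_LIinv_single (l : ℕ) :
    P.upCoef 0 l * (P.LIinv (Pi.single 0 1) l / P.piv l) = P.wTerm l := by
  have := H.dlt_ne_zero l
  have := H.dlt_ne_zero (l + 1)
  have hsq : ((-1 : ℝ) ^ l) * (-1) ^ l = 1 := by rw [← mul_pow, neg_one_mul, neg_neg, one_pow]
  simp only [H.LIinv_single, upCoef, wTerm, piv, zero_add]
  field_simp
  linear_combination (P.dlt 0 ^ 2 * (∏ i ∈ Finset.Icc 1 l, P.c i)
    * ∏ i ∈ Finset.Icc 2 (l + 1), P.a i) * hsq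

theorem hasSum_wTerm : HasSum P.wTerm (P.w 0) := by
  have h := H.hasSum_tailInv (fun n => (P.abs_single_div_piv_le n).trans (P.single_inv_le n)) 0
  simp only [zero_add, H.upCoef_mul_LIinv_single] at h
  exact h

theorem abs_wTerm_le (l : ℕ) : |P.wTerm l| ≤ 1 / |P.b 1| * (P.theta ^ 2) ^ l := by
  have hL := H.abs_LIinv_div_piv_le P.abs_single_div_piv_le l
  rw [geomConv_single] at hL
  rw [← H.upCoef_mul_LIinv_single]
  refine (abs_mul_le_of_le (H.abs_upCoef_le 0 l) hL).trans_eq ?_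
  ring

theorem abs_w_zero_sub_wtilde_le :
    |P.w 0 - P.wtilde| ≤ P.theta ^ (2 * P.L) / (|P.b 1| * (1 - P.theta ^ 2)) := by
  have hθ : P.theta ^ 2 < 1 := sub_pos.1 H.one_sub_theta_sq_pos
  have hpow : (P.theta ^ 2) ^ max P.L 1 ≤ P.theta ^ (2 * P.L) := by
    rw [pow_mul]
    exact pow_le_pow_of_le_one (sq_nonneg _) hθ.le (le_max_left _ _)
  rw [wtilde_eq_sum, abs_sub_comm]
  calc _ ≤ 1 / |P.b 1| * (P.theta ^ 2) ^ max P.L 1 / (1 - P.theta ^ 2) :=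
        norm_sub_le_of_geometric_bound_of_hasSum hθ H.abs_wTerm_le H.hasSum_wTerm _
    _ ≤ 1 / |P.b 1| * P.theta ^ (2 * P.L) / (1 - P.theta ^ 2) := by
        have := H.one_sub_theta_sq_pos.le
        gcongr
    _ = _ := by rw [one_div_mul_eq_div, div_div]

end TailDominant

end Data

/-! ### Weighted geometric convolutions -/

theorem exp_mul_rpow_le {t p a b : ℝ} (ha : 0 < a) (hab : a ≤ b) (hp : 0 ≤ p)
    (h : t + p / a ≤ 0) : Real.exp (t * (b - a)) * b ^ p ≤ a ^ p := by
  have hb : b ≤ a * Real.exp ((b - a) / a) := by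
    have hab' : (b - a) / a + 1 = b / a := by rw [sub_div, div_self ha.ne', sub_add_cancel]
    rw [← div_le_iff₀' ha, ← hab']
    exact Real.add_one_le_exp _
  calc Real.exp (t * (b - a)) * b ^ p
      ≤ Real.exp (t * (b - a)) * (a * Real.exp ((b - a) / a)) ^ p := by
        have : 0 ≤ b := ha.le.trans hab
        gcongr
    _ = Real.exp ((b - a) * (t + p / a)) * a ^ p := by
        rw [Real.mul_rpow ha.le (Real.exp_pos _).le, ← Real.exp_mul, mul_left_comm,
          ← Real.exp_add, mul_comm (a ^ p)]
        ring_nf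
    _ ≤ 1 * a ^ p := by
        gcongr
        exact Real.exp_le_one_iff.2 (mul_nonpos_of_nonneg_of_nonpos (sub_nonneg.2 hab) h)
    _ = a ^ p := one_mul _

theorem rpow_eq_rpow_mul_exp {θ : ℝ} (hθ : 0 < θ) (u v : ℝ) :
    θ ^ v = θ ^ u * Real.exp (Real.log θ * (v - u)) := by
  rw [Real.rpow_def_of_pos hθ, Real.rpow_def_of_pos hθ, ← Real.exp_add]
  ring_nf

theorem pow_mul_rpow_le {θ p m : ℝ} (hθ : 0 < θ) (hp : 0 ≤ p) (hm : 0 < m) {M k : ℕ}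
    (hMk : M ≤ k) (h : Real.log θ + p / (m + M) ≤ 0) :
    θ ^ k * (m + k) ^ p ≤ θ ^ M * (m + M) ^ p := by
  have hMk' : (M : ℝ) ≤ k := by exact_mod_cast hMk
  have hexp := rpow_eq_rpow_mul_exp hθ M k
  rw [Real.rpow_natCast, Real.rpow_natCast] at hexp
  have hle := exp_mul_rpow_le (by positivity) (add_le_add_right hMk' m) hp h
  rw [add_sub_add_left_eq_sub] at hle
  rw [hexp, mul_assoc]
  gcongr

theorem rpow_half_mul_le {θ p m : ℝ} (hθ : 0 < θ) (hp : 0 ≤ p) (hm : 0 < m) {M k : ℕ}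
    (hM : 0 < M) (hMk : M ≤ k) (h : Real.log θ / 2 + 1 / M + p / (m + M) ≤ 0) :
    θ ^ ((k : ℝ) / 2) * ((k : ℝ) / 2) * ((m + k) / m) ^ p
      ≤ θ ^ ((M : ℝ) / 2) * ((M : ℝ) / 2) * ((m + M) / m) ^ p := by
  have hM' : (0 : ℝ) < M := by exact_mod_cast hM
  have hMk' : (M : ℝ) ≤ k := by exact_mod_cast hMk
  have hlin : Real.exp (-(1 / M) * (k - M)) * k ≤ M := by
    simpa only [Real.rpow_one] using
      exp_mul_rpow_le hM' hMk' zero_le_one (neg_add_cancel (1 / (M : ℝ))).le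
  have hpow : Real.exp ((Real.log θ / 2 + 1 / M) * (k - M)) * (m + k) ^ p ≤ (m + M) ^ p := by
    have := exp_mul_rpow_le (by positivity) (add_le_add_right hMk' m) hp h
    rwa [add_sub_add_left_eq_sub] at this
  have hexp : θ ^ ((k : ℝ) / 2) = θ ^ ((M : ℝ) / 2)
      * (Real.exp (-(1 / M) * (k - M)) * Real.exp ((Real.log θ / 2 + 1 / M) * (k - M))) := by
    rw [rpow_eq_rpow_mul_exp hθ ((M : ℝ) / 2), ← Real.exp_add]
    ring_nf
  rw [Real.div_rpow (by positivity) hm.le, Real.div_rpow (by positivity) hm.le, hexp]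
  calc θ ^ ((M : ℝ) / 2) * (Real.exp (-(1 / M) * (k - M))
        * Real.exp ((Real.log θ / 2 + 1 / M) * (k - M))) * ((k : ℝ) / 2) * ((m + k) ^ p / m ^ p)
      = θ ^ ((M : ℝ) / 2) * ((Real.exp (-(1 / M) * (k - M)) * k) / 2)
        * (Real.exp ((Real.log θ / 2 + 1 / M) * (k - M)) * (m + k) ^ p / m ^ p) := by ring
    _ ≤ θ ^ ((M : ℝ) / 2) * ((M : ℝ) / 2) * ((m + M) ^ p / m ^ p) := by gcongr

theorem rpow_sqrt_mul_le {θ : ℝ} (hθ : 0 < θ) (hθ1 : θ < 1) {M k : ℕ} (hM : 0 < M) (hMk : M ≤ k)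
    (h : 4 / Real.log θ ^ 2 ≤ M) :
    θ ^ Real.sqrt k * ((k : ℝ) / 2) ≤ θ ^ Real.sqrt M * ((M : ℝ) / 2) := by
  have hlog : Real.log θ < 0 := Real.log_neg hθ hθ1
  have hM' : 0 < Real.sqrt M := Real.sqrt_pos.2 (by exact_mod_cast hM)
  have hsqrt : Real.sqrt M ≤ Real.sqrt k := Real.sqrt_le_sqrt (by exact_mod_cast hMk)
  have hcrit : Real.log θ + 2 / Real.sqrt M ≤ 0 := by
    have h2 : 2 / -Real.log θ ≤ Real.sqrt M := by
      refine Real.le_sqrt_of_sq_le ?_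
      rwa [div_pow, neg_sq, show (2 : ℝ) ^ 2 = 4 by norm_num]
    rw [div_le_comm₀ (neg_pos.2 hlog) hM'] at h2
    linarith
  have hle := exp_mul_rpow_le hM' hsqrt zero_le_two hcrit
  rw [Real.rpow_two, Real.rpow_two, Real.sq_sqrt (Nat.cast_nonneg k),
    Real.sq_sqrt (Nat.cast_nonneg M)] at hle
  rw [rpow_eq_rpow_mul_exp hθ (Real.sqrt M) (Real.sqrt k), mul_assoc, ← mul_div_assoc]
  gcongr

theorem quadratic_nonpos_of_root_le {t B c x : ℝ} (ht : t < 0) (hc : 0 ≤ c)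
    (h : (-B - Real.sqrt (B ^ 2 - 4 * t * c)) / (2 * t) ≤ x) : t * x ^ 2 + B * x + c ≤ 0 := by
  rw [div_le_iff_of_neg (by linarith)] at h
  have hdiscr : 0 ≤ B ^ 2 - 4 * t * c := by nlinarith [sq_nonneg B]
  have hsq : B ^ 2 - 4 * t * c ≤ (-(2 * t * x + B)) ^ 2 := by
    rw [← Real.sq_sqrt hdiscr]
    exact pow_le_pow_left₀ (Real.sqrt_nonneg _) (by linarith) 2
  nlinarith

theorem add_sub_sqrt_sub_one_pos {m : ℝ} (hm : 2 ≤ m) (k : ℕ) :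
    0 < m + k - Real.sqrt k - 1 := by
  have h := Real.sq_sqrt (Nat.cast_nonneg k : (0 : ℝ) ≤ k)
  nlinarith [sq_nonneg (Real.sqrt k - 1)]

theorem div_sub_sqrt_le {m : ℝ} (hm : 2 ≤ m) {M k : ℕ} (hmM : m ≤ M) (hMk : M ≤ k) :
    (m + k) / (m + k - Real.sqrt k - 1) ≤ (m + M) / (m + M - Real.sqrt M - 1) := by
  rw [div_le_div_iff₀ (add_sub_sqrt_sub_one_pos hm k) (add_sub_sqrt_sub_one_pos hm M)]
  have huv : Real.sqrt M ≤ Real.sqrt k := Real.sqrt_le_sqrt (by exact_mod_cast hMk)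
  have hu2 := Real.sq_sqrt (Nat.cast_nonneg M : (0 : ℝ) ≤ M)
  have hv2 := Real.sq_sqrt (Nat.cast_nonneg k : (0 : ℝ) ≤ k)
  set u := Real.sqrt M with hu
  set v := Real.sqrt k
  have hu0 : 0 ≤ u := hu ▸ Real.sqrt_nonneg _
  have h1 : 0 ≤ (v - u) * (u * v + v + u - m) :=
    mul_nonneg (by linarith) (by nlinarith)
  rw [← hu2, ← hv2]
  linarith

theorem geomConv_eq_sum_pow_mul_sub (θ : ℝ) (Y : ℕ → ℝ) (n : ℕ) :
    geomConv θ Y n = ∑ i ∈ Finset.range (n + 1), θ ^ i * Y (n - i) := by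
  rw [geomConv, ← Finset.sum_range_reflect]
  refine Finset.sum_congr rfl fun i hi => ?_
  have := Finset.mem_range.1 hi
  rw [show n - (n + 1 - 1 - i) = i by omega, show n + 1 - 1 - i = n - i by omega]

theorem sum_le_sum_add_card_mul {ι : Type*} {s A B : Finset ι} {f g : ι → ℝ}
    {c d : ℝ} (hg : ∀ i ∈ s, 0 ≤ g i) (hc : 0 ≤ c) (hd : 0 ≤ d)
    (h : ∀ i ∈ s, f i ≤ g i ∨ i ∈ A ∧ f i ≤ c ∨ i ∈ B ∧ f i ≤ d) :
    ∑ i ∈ s, f i ≤ ∑ i ∈ s, g i + A.card * c + B.card * d := by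
  classical
  have hcard (E : Finset ι) {e : ℝ} (he : 0 ≤ e) :
      ∑ i ∈ s, (if i ∈ E then e else 0) ≤ E.card * e := by
    rw [Finset.sum_ite_mem, Finset.sum_const, nsmul_eq_mul]
    gcongr
    exact Finset.inter_subset_right
  have hsum : ∑ i ∈ s, f i
      ≤ ∑ i ∈ s, (g i + (if i ∈ A then c else 0) + if i ∈ B then d else 0) := by
    refine Finset.sum_le_sum fun i hi => ?_
    have := hg i hi
    rcases h i hi with h | ⟨hiA, h⟩ | ⟨hiB, h⟩
    · split_ifs <;> linarith
    · rw [if_pos hiA]; split_ifs <;> linarith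
    · rw [if_pos hiB]; split_ifs <;> linarith
  rw [Finset.sum_add_distrib, Finset.sum_add_distrib] at hsum
  linarith [hcard A hc, hcard B hd]

-- The ranges are `i ≤ √k + 1`, `√k + 2 ≤ i ≤ (k + 1) / 2` and `i > (k + 1) / 2`.
theorem pow_mul_div_rpow_le_cases {θ p m : ℝ} (hθ : 0 < θ) (hθ1 : θ < 1) (hp : 0 ≤ p)
    (hm : 2 ≤ m) {k i : ℕ} (hik : i ≤ k) :
    θ ^ i * ((m + k) / (m + (k - i : ℕ))) ^ p
        ≤ θ ^ i * ((m + k) / (m + k - Real.sqrt k - 1)) ^ p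
      ∨ i ∈ Finset.Icc (Nat.sqrt k + 2) ((k + 1) / 2)
        ∧ θ ^ i * ((m + k) / (m + (k - i : ℕ))) ^ p ≤ θ ^ Real.sqrt k * (2 : ℝ) ^ p
      ∨ i ∈ Finset.Icc ((k + 1) / 2 + 1) k
        ∧ θ ^ i * ((m + k) / (m + (k - i : ℕ))) ^ p
          ≤ θ ^ ((k : ℝ) / 2) * ((m + k) / m) ^ p := by
  have : (0 : ℝ) ≤ k := Nat.cast_nonneg k
  have hik' : (i : ℝ) ≤ k := by exact_mod_cast hik
  have : 0 < m := by linarith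
  have hle {e q : ℝ} (hie : e ≤ i) (hq : (m + k) / (m + (k - i : ℕ)) ≤ q) :
      θ ^ i * ((m + k) / (m + (k - i : ℕ))) ^ p ≤ θ ^ e * q ^ p := by
    rw [← Real.rpow_natCast θ i]
    have := Real.rpow_le_rpow_of_exponent_ge hθ hθ1.le hie
    gcongr
  rcases Nat.lt_or_ge i (Nat.sqrt k + 2) with hi1 | hi1
  · refine Or.inl ((hle le_rfl ?_).trans_eq (by rw [Real.rpow_natCast]))
    have : (i : ℝ) ≤ Nat.sqrt k + 1 := by exact_mod_cast Nat.lt_succ_iff.1 hi1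
    have := Real.nat_sqrt_le_real_sqrt (a := k)
    rw [Nat.cast_sub hik]
    exact div_le_div_of_nonneg_left (by linarith) (add_sub_sqrt_sub_one_pos hm k) (by linarith)
  rcases Nat.lt_or_ge ((k + 1) / 2) i with hi2 | hi2
  · refine Or.inr (Or.inr ⟨Finset.mem_Icc.2 ⟨hi2, hik⟩, hle ?_ ?_⟩)
    · rw [div_le_iff₀ two_pos]
      exact_mod_cast (by omega : k ≤ i * 2)
    · gcongr
      exact le_add_of_nonneg_right (Nat.cast_nonneg _)
  · refine Or.inr (Or.inl ⟨Finset.mem_Icc.2 ⟨hi1, hi2⟩, hle ?_ ?_⟩)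
    · have : (Nat.sqrt k : ℝ) + 2 ≤ i := by exact_mod_cast hi1
      linarith [Real.real_sqrt_lt_nat_sqrt_succ (a := k)]
    · have : (i : ℝ) * 2 ≤ k + 1 := by exact_mod_cast (by omega : i * 2 ≤ k + 1)
      rw [Nat.cast_sub hik, div_le_iff₀ (by linarith)]
      linarith

theorem geomConv_div_rpow_le {θ p m : ℝ} (hθ : 0 < θ) (hθ1 : θ < 1) (hp : 0 ≤ p) (hm : 2 ≤ m)
    (k : ℕ) :
    geomConv θ (fun l => ((m + k) / (m + l)) ^ p) k
      ≤ θ ^ ((k : ℝ) / 2) * ((k : ℝ) / 2) * ((m + k) / m) ^ p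
        + θ ^ Real.sqrt k * ((k : ℝ) / 2) * (2 : ℝ) ^ p
        + 1 / (1 - θ) * ((m + k) / (m + k - Real.sqrt k - 1)) ^ p := by
  have : 0 < m := by linarith
  set R : ℝ := (m + k) / (m + k - Real.sqrt k - 1)
  have hR : 0 ≤ R ^ p :=
    Real.rpow_nonneg (div_nonneg (by positivity) (add_sub_sqrt_sub_one_pos hm k).le) p
  have hgeom : ∑ i ∈ Finset.range (k + 1), θ ^ i ≤ 1 / (1 - θ) := by
    rw [one_div, ← tsum_geometric_of_lt_one hθ.le hθ1]
    exact (summable_geometric_of_lt_one hθ.le hθ1).sum_le_tsum _ fun i _ => pow_nonneg hθ.le i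
  have hcard (a b : ℕ) (hab : (b + 1 - a) * 2 ≤ k) :
      ((Finset.Icc a b).card : ℝ) ≤ (k : ℝ) / 2 := by
    rw [Nat.card_Icc, le_div_iff₀ two_pos]
    exact_mod_cast hab
  rw [geomConv_eq_sum_pow_mul_sub]
  calc _ ≤ ∑ i ∈ Finset.range (k + 1), θ ^ i * R ^ p
        + (Finset.Icc (Nat.sqrt k + 2) ((k + 1) / 2)).card * (θ ^ Real.sqrt k * (2 : ℝ) ^ p)
        + (Finset.Icc ((k + 1) / 2 + 1) k).card * (θ ^ ((k : ℝ) / 2) * ((m + k) / m) ^ p) :=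
        sum_le_sum_add_card_mul (fun i _ => mul_nonneg (pow_nonneg hθ.le i) hR) (by positivity)
          (by positivity) fun i hi => pow_mul_div_rpow_le_cases hθ hθ1 hp hm
            (Nat.lt_succ_iff.1 (Finset.mem_range.1 hi))
    _ ≤ 1 / (1 - θ) * R ^ p + (k : ℝ) / 2 * (θ ^ Real.sqrt k * (2 : ℝ) ^ p)
        + (k : ℝ) / 2 * (θ ^ ((k : ℝ) / 2) * ((m + k) / m) ^ p) := by
        rw [← Finset.sum_mul]
        gcongr
        · exact hcard _ _ (by omega)
        · exact hcard _ _ (by omega)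
    _ = _ := by ring

theorem exists_geomConv_div_rpow_le {θ p m : ℝ} (hθ : 0 < θ) (hθ1 : θ < 1) (hp : 0 ≤ p)
    (hm : 1 ≤ m) :
    ∃ C, ∀ k : ℕ, geomConv θ (fun l => ((m + k) / (m + l)) ^ p) k ≤ C := by
  obtain ⟨d, hd⟩ := exists_nat_ge p
  have hsum : Summable fun i : ℕ => θ ^ i * ((i : ℝ) + 1) ^ d := by
    have hnorm : ‖θ‖ < 1 := by rwa [Real.norm_of_nonneg hθ.le]
    have h := (summable_nat_add_iff 1).2
      (summable_pow_mul_geometric_of_norm_lt_one (R := ℝ) d hnorm)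
    refine (h.mul_right θ⁻¹).congr fun i => ?_
    push_cast
    rw [pow_succ]
    field_simp
  refine ⟨∑' i : ℕ, θ ^ i * ((i : ℝ) + 1) ^ d, fun k => ?_⟩
  rw [geomConv_eq_sum_pow_mul_sub]
  refine le_trans (Finset.sum_le_sum fun i hi => ?_)
    (hsum.sum_le_tsum (Finset.range (k + 1)) fun i _ => by positivity)
  have hik : i ≤ k := Nat.lt_succ_iff.1 (Finset.mem_range.1 hi)
  have hik' : (i : ℝ) ≤ k := by exact_mod_cast hik
  have hratio : (m + k) / (m + (k - i : ℕ)) ≤ (i : ℝ) + 1 := by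
    rw [Nat.cast_sub hik, div_le_iff₀ (by linarith)]
    nlinarith
  have hexp : ((i : ℝ) + 1) ^ p ≤ ((i : ℝ) + 1) ^ d := by
    rw [← Real.rpow_natCast]
    exact Real.rpow_le_rpow_of_exponent_le (by linarith [Nat.cast_nonneg (α := ℝ) i]) hd
  gcongr
  exact (Real.rpow_le_rpow (by positivity) hratio hp).trans hexp

namespace Data

variable {P : Data}

namespace TailDominant

variable (H : P.TailDominant)

include H

theorem log_sqrt_add_le_of_condMA {M : ℕ} (hMA : P.CondMA M) :
    Real.log P.theta / 2 + 1 / M + (P.s + P.sL) / (P.m + M) ≤ 0 := by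
  obtain ⟨⟨hroot, -⟩, hmM⟩ := (max_le_iff.1 hMA).imp_left max_le_iff.1
  have hm0 : (0 : ℝ) < P.m := by exact_mod_cast P.m_pos
  have hM0 : (0 : ℝ) < M := hm0.trans_le hmM
  have hlog : Real.log P.theta / 2 < 0 := by linarith [Real.log_neg H.theta_pos H.theta_lt_one]
  rw [Real.log_sqrt H.theta_pos.le] at hroot
  have hquad := quadratic_nonpos_of_root_le (x := M) (c := P.m)
    (B := P.m * (Real.log P.theta / 2) + P.s + P.sL + 1) hlog hm0.le
    (le_of_eq_of_le (by ring_nf) hroot)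
  have hrat : Real.log P.theta / 2 + 1 / M + (P.s + P.sL) / (P.m + M)
      = (Real.log P.theta / 2 * (M : ℝ) ^ 2
        + (P.m * (Real.log P.theta / 2) + P.s + P.sL + 1) * M + P.m) / (M * (P.m + M)) := by
    have : (P.m : ℝ) + M ≠ 0 := by positivity
    field_simp
    ring
  rw [hrat]
  exact div_nonpos_of_nonpos_of_nonneg hquad (by positivity)

theorem geomConv_le_chi (hs : 0 ≤ P.s + P.sL) (hm : 2 ≤ P.m) {M k : ℕ} (hMA : P.CondMA M)
    (hk : M ≤ k) :
    geomConv P.theta (fun l => (((P.m : ℝ) + k) / (P.m + l)) ^ (P.s + P.sL)) k ≤ P.chi M := by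
  have hm' : (2 : ℝ) ≤ P.m := by exact_mod_cast hm
  obtain ⟨⟨-, hlog⟩, hmM⟩ := (max_le_iff.1 hMA).imp_left max_le_iff.1
  have hM0 : 0 < M := P.m_pos.trans_le (by exact_mod_cast hmM)
  have := sub_nonneg.2 H.theta_lt_one.le
  refine (geomConv_div_rpow_le H.theta_pos H.theta_lt_one hs hm' k).trans ?_
  unfold chi
  gcongr ?_ + ?_ * _ + _ * ?_ ^ _
  · exact rpow_half_mul_le H.theta_pos hs (by linarith) hM0 hk (H.log_sqrt_add_le_of_condMA hMA)
  · exact rpow_sqrt_mul_le H.theta_pos H.theta_lt_one hM0 hk hlog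
  · exact div_nonneg (by positivity) (add_sub_sqrt_sub_one_pos hm' k).le
  · exact div_sub_sqrt_le hm' hmM hk

theorem theta_pow_le (hs : 0 ≤ P.s) {M k : ℕ} (hMY : P.CondMY M) (hk : M ≤ k) :
    P.theta ^ k ≤ P.theta ^ M * (wt P.s (P.m + M) / wt P.s (P.m + k)) := by
  have hm0 : (0 : ℝ) < P.m := by exact_mod_cast P.m_pos
  have hlog : Real.log P.theta < 0 := Real.log_neg H.theta_pos H.theta_lt_one
  have hcrit : Real.log P.theta + P.s / (P.m + M) ≤ 0 := by
    have hY : -P.s / Real.log P.theta ≤ P.m + M := by linarith [(max_le_iff.1 hMY).1]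
    rw [div_le_iff_of_neg hlog] at hY
    have : P.s / (P.m + M) ≤ -Real.log P.theta := by
      rw [div_le_iff₀ (by positivity)]
      linarith
    linarith
  rw [← mul_div_assoc, le_div_iff₀ (wt_pos _ _), wt_add_left P.m_pos, wt_add_left P.m_pos]
  exact pow_mul_rpow_le H.theta_pos hs hm0 hk hcrit

end TailDominant

end Data

theorem forall_fin_or_add (m : ℕ) {p : ℕ → Prop} (hfin : ∀ i : Fin m, p i)
    (hadd : ∀ n, p (m + n)) (k : ℕ) : p k := by
  rcases lt_or_ge k m with h | h
  · exact hfin ⟨k, h⟩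
  · exact Nat.add_sub_cancel' h ▸ hadd (k - m)

theorem geomConv_div_wt (θ c p : ℝ) {m : ℕ} (hm : 0 < m) (k : ℕ) :
    geomConv θ (fun n => c / wt p (m + n)) k
      = c / wt p (m + k) * geomConv θ (fun l => (((m : ℝ) + k) / (m + l)) ^ p) k := by
  rw [geomConv, geomConv, Finset.mul_sum]
  refine Finset.sum_congr rfl fun l _ => ?_
  rw [Real.div_rpow (by positivity) (by positivity), ← wt_add_left hm, ← wt_add_left hm]
  have := (wt_pos p (m + k)).ne'
  field_simp

theorem tsum_pow_mul_div_wt_le {θ c p : ℝ} (hθ : 0 ≤ θ) (hθ1 : θ < 1) (hc : 0 ≤ c) (hp : 0 ≤ p)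
    (k : ℕ) :
    ∑' l : ℕ, θ ^ (l + 1) * (c / wt p (k + (l + 1))) ≤ c / wt p k * (θ / (1 - θ)) := by
  have hgeom := (hasSum_geometric_of_lt_one hθ hθ1).mul_right (θ * (c / wt p k))
  have hle (l : ℕ) : θ ^ (l + 1) * (c / wt p (k + (l + 1))) ≤ θ ^ l * (θ * (c / wt p k)) := by
    rw [pow_succ, mul_assoc]
    have := wt_pos p k
    gcongr
    exact wt_mono hp (by omega)
  have hsum : Summable fun l : ℕ => θ ^ (l + 1) * (c / wt p (k + (l + 1))) :=
    hgeom.summable.of_nonneg_of_le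
      (fun l => mul_nonneg (pow_nonneg hθ _) (div_nonneg hc (wt_pos _ _).le)) hle
  refine (hsum.tsum_le_tsum hle hgeom.summable).trans_eq ?_
  rw [hgeom.tsum_eq, div_eq_mul_inv θ]
  ring

namespace Data

variable {P : Data}

theorem tail_add (y z : ℕ → ℝ) : P.tail (y + z) = P.tail y + P.tail z := rfl

theorem tail_smul (r : ℝ) (y : ℕ → ℝ) : P.tail (r • y) = r • P.tail y := rfl

variable (P) in
theorem A_fin (y : ℕ → ℝ) (i : Fin P.m) :
    P.A y i = (∑ j, P.Am i j * y j)
      - P.beta (P.m - 1) * (P.Am i P.last * P.tailInv (P.tail y) 0) := by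
  simp [A]

-- The rows of `A` below the block only see the block through `(A y)_{m-1}`.
variable (P) in
theorem A_tail (y : ℕ → ℝ) (n : ℕ) :
    P.A y (P.m + n) = -P.lam P.m * P.w n * P.A y P.last + P.tailInv (P.tail y) n := by
  rw [A_fin]
  simp only [A, not_lt.2 (Nat.le_add_right P.m n), dite_false, Nat.add_sub_cancel_left]
  ring

theorem abs_A_fin_le {y : ℕ → ℝ} {C : Fin P.m → ℝ} {q : ℝ} (hC : ∀ j : Fin P.m, |y j| ≤ C j)
    (hq : |P.tailInv (P.tail y) 0| ≤ q) (i : Fin P.m) :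
    |P.A y i| ≤ (∑ j, |P.Am i j| * C j) + |P.beta (P.m - 1)| * q * |P.Am i P.last| := by
  rw [A_fin]
  refine (abs_sub _ _).trans (add_le_add ?_ ?_)
  · exact (Finset.abs_sum_le_sum_abs _ _).trans
      (Finset.sum_le_sum fun j _ => abs_mul_le_of_le le_rfl (hC j))
  · exact (abs_mul_le_of_le le_rfl (abs_mul_le_of_le le_rfl hq)).trans_eq (by ring)

theorem TailDominant.abs_A_tail_le (H : P.TailDominant) (y : ℕ → ℝ) {E q : ℝ} {n : ℕ}
    (hE : |P.A y P.last| ≤ E) (hq : |P.tailInv (P.tail y) n| ≤ q) :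
    |P.A y (P.m + n)| ≤ E * P.eta * (|P.lam P.m| / |P.mu P.m|) * P.theta ^ n + q := by
  rw [A_tail]
  refine (abs_add_le _ _).trans (add_le_add ?_ hq)
  rw [neg_mul, neg_mul, abs_neg]
  refine (abs_mul_le_of_le (abs_mul_le_of_le le_rfl (H.abs_w_le n)) hE).trans_eq ?_
  rw [show P.b 1 = P.mu P.m from rfl]
  ring

namespace Assumptions

variable {C2 : ℝ} {k0 : ℕ} (hA : P.Assumptions C2 k0) (hk0 : k0 ≤ P.m)

include hA hk0

theorem abs_div_piv_le {t κ : ℝ} {y : ℕ → ℝ} (hy : ∀ n, |y n| ≤ κ / wt t (P.m + n)) (n : ℕ) :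
    |y n / P.piv n| ≤ κ / (P.gamma * P.C1) / wt (t + P.sL) (P.m + n) := by
  have hγ := P.gamma_pos
  have hpiv : P.gamma * (P.C1 * wt P.sL (P.m + n)) ≤ |P.piv n| :=
    (mul_le_mul_of_nonneg_left (hA.mul_wt_le_abs_mu (by omega)) hγ.le).trans
      ((hA.tailDominant hk0).gamma_mul_le_abs_piv n)
  rw [abs_div]
  refine (div_le_div₀ ((abs_nonneg _).trans (hy n)) (hy n)
    (mul_pos hγ (mul_pos hA.C1_pos (wt_pos _ _))) hpiv).trans_eq ?_
  rw [wt_add, div_div, div_div]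
  ring_nf

theorem abs_tailInv_le {t κ : ℝ} (ht : 0 ≤ t + P.sL) {y : ℕ → ℝ}
    (hy : ∀ n, |y n| ≤ κ / wt t (P.m + n)) (k : ℕ) :
    |P.tailInv y k| ≤ P.eta * κ / (P.C1 * wt (t + P.sL) (P.m + k))
      * (geomConv P.theta (fun l => (((P.m : ℝ) + k) / (P.m + l)) ^ (t + P.sL)) k
        + P.theta / (1 - P.theta)) := by
  have H := hA.tailDominant hk0
  set c : ℝ := κ / (P.gamma * P.C1)
  have hc : 0 ≤ c := div_nonneg (nonneg_of_abs_le_div_wt (hy 0))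
    (mul_pos (P.gamma_pos) hA.C1_pos).le
  calc |P.tailInv y k| ≤ _ := H.abs_tailInv_le (Y := fun n => c / wt (t + P.sL) (P.m + n))
        (hA.abs_div_piv_le hk0 hy) (fun n => div_le_self hc (one_le_wt ht _)) k
    _ ≤ (c / wt (t + P.sL) (P.m + k)
          * geomConv P.theta (fun l => (((P.m : ℝ) + k) / (P.m + l)) ^ (t + P.sL)) k
          + c / wt (t + P.sL) (P.m + k) * (P.theta / (1 - P.theta))) / (1 - P.theta ^ 2) := by
        have := H.one_sub_theta_sq_pos.le
        rw [geomConv_div_wt _ _ _ P.m_pos]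
        gcongr
        simpa only [add_assoc] using
          tsum_pow_mul_div_wt_le H.theta_pos.le H.theta_lt_one hc ht (P.m + k)
    _ = _ := by
        unfold eta
        have := (P.gamma_pos).ne'
        have := hA.C1_pos.ne'
        simp only [c]
        field_simp

theorem exists_abs_tail_div_piv_le (hs : 0 ≤ P.s) {y : ℕ → ℝ} (hy : MemOmega (P.s - P.sL) y) :
    ∃ B, ∀ n, |P.tail y n / P.piv n| ≤ B := by
  have hle := hA.abs_div_piv_le hk0 fun n => hy.abs_le (P.m + n)
  refine ⟨_, fun n => (hle n).trans (div_le_self ?_ (one_le_wt (by linarith) _))⟩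
  exact div_nonneg (omegaNorm_nonneg _ _) (mul_pos (P.gamma_pos) hA.C1_pos).le

theorem A_add (hs : 0 ≤ P.s) {y z : ℕ → ℝ} (hy : MemOmega (P.s - P.sL) y)
    (hz : MemOmega (P.s - P.sL) z) : P.A (y + z) = P.A y + P.A z := by
  obtain ⟨B, hB⟩ := hA.exists_abs_tail_div_piv_le hk0 hs hy
  obtain ⟨C, hC⟩ := hA.exists_abs_tail_div_piv_le hk0 hs hz
  have hQ := (hA.tailDominant hk0).tailInv_add hB hC
  have hfin (i : Fin P.m) : P.A (y + z) i = P.A y i + P.A z i := by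
    simp only [A_fin, tail_add, hQ, Pi.add_apply, mul_add, Finset.sum_add_distrib]
    ring
  refine funext (forall_fin_or_add P.m hfin fun n => ?_)
  rw [Pi.add_apply, A_tail, A_tail, A_tail, hfin, tail_add, hQ, Pi.add_apply]
  ring

theorem A_smul (hs : 0 ≤ P.s) (r : ℝ) {y : ℕ → ℝ} (hy : MemOmega (P.s - P.sL) y) :
    P.A (r • y) = r • P.A y := by
  obtain ⟨B, hB⟩ := hA.exists_abs_tail_div_piv_le hk0 hs hy
  have hQ := (hA.tailDominant hk0).tailInv_smul r hB
  have hfin (i : Fin P.m) : P.A (r • y) i = r * P.A y i := by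
    simp only [A_fin, tail_smul, hQ, Pi.smul_apply, smul_eq_mul, mul_sub, Finset.mul_sum,
      mul_left_comm r]
  refine funext (forall_fin_or_add P.m hfin fun n => ?_)
  rw [Pi.smul_apply, A_tail, A_tail, hfin, tail_smul, hQ, Pi.smul_apply, smul_eq_mul, smul_eq_mul]
  ring

theorem exists_abs_tailInv_le {t : ℝ} (ht : 0 ≤ t + P.sL) :
    ∃ C, ∀ (y : ℕ → ℝ) (κ : ℝ), (∀ n, |y n| ≤ κ / wt t (P.m + n)) →
      ∀ n, |P.tailInv y n| ≤ C * κ / wt (t + P.sL) (P.m + n) := by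
  have H := hA.tailDominant hk0
  obtain ⟨B, hB⟩ := exists_geomConv_div_rpow_le (m := P.m) H.theta_pos H.theta_lt_one ht
    (by exact_mod_cast P.m_pos)
  refine ⟨P.eta / P.C1 * (B + P.theta / (1 - P.theta)), fun y κ hy n => ?_⟩
  have hfactor : 0 ≤ P.eta * κ / (P.C1 * wt (t + P.sL) (P.m + n)) :=
    div_nonneg (mul_nonneg H.eta_pos.le (nonneg_of_abs_le_div_wt (hy 0)))
      (mul_pos hA.C1_pos (wt_pos _ _)).le
  refine (hA.abs_tailInv_le hk0 ht hy n).trans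
    ((mul_le_mul_of_nonneg_left (add_le_add_left (hB n) _) hfactor).trans_eq ?_)
  field_simp

theorem exists_abs_A_fin_le (hs : 0 ≤ P.s) :
    ∃ C, ∀ (y : ℕ → ℝ) (r : ℝ), (∀ j, |y j| ≤ r / wt (P.s - P.sL) j) →
      ∀ i : Fin P.m, |P.A y i| ≤ C * r := by
  obtain ⟨q, hq⟩ := hA.exists_abs_tailInv_le hk0 (t := P.s - P.sL) (by linarith)
  set G : Fin P.m → ℝ := fun i => (∑ j, |P.Am i j| / wt (P.s - P.sL) j)
    + |P.beta (P.m - 1)| * (q / wt P.s P.m) * |P.Am i P.last|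
  refine ⟨∑ i, |G i|, fun y r hy i => ?_⟩
  have hr : 0 ≤ r := nonneg_of_abs_le_div_wt (hy 0)
  have hQ : |P.tailInv (P.tail y) 0| ≤ q * r / wt P.s P.m := by
    simpa only [sub_add_cancel, add_zero] using hq (P.tail y) r (fun n => hy (P.m + n)) 0
  calc |P.A y i| ≤ _ := abs_A_fin_le (fun j : Fin P.m => hy j) hQ i
    _ = G i * r := by
        simp only [G, add_mul, Finset.sum_mul]
        congr 1
        · exact Finset.sum_congr rfl fun j _ => by ring
        · ring
    _ ≤ (∑ i, |G i|) * r := by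
        gcongr
        exact (le_abs_self _).trans
          (Finset.single_le_sum (fun i _ => abs_nonneg (G i)) (Finset.mem_univ i))

theorem exists_abs_A_le (hs : 0 ≤ P.s) :
    ∃ C, ∀ (y : ℕ → ℝ) (r : ℝ), (∀ j, |y j| ≤ r / wt (P.s - P.sL) j) →
      ∀ k, |P.A y k| ≤ C * r / wt P.s k := by
  obtain ⟨q, hq⟩ := hA.exists_abs_tailInv_le hk0 (t := P.s - P.sL) (by linarith)
  simp only [sub_add_cancel] at hq
  obtain ⟨E, hE⟩ := hA.exists_abs_A_fin_le hk0 hs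
  have hw := hq (Pi.single 0 1) (wt (P.s - P.sL) P.m) fun n => by
    rcases n with _ | n
    · simp [(wt_pos _ _).ne']
    · simpa using div_nonneg (wt_pos _ _).le (wt_pos _ _).le
  set K := |P.lam P.m| * (q * wt (P.s - P.sL) P.m) * E + q
  refine ⟨max (E * wt P.s P.m) K, fun y r hy => forall_fin_or_add P.m (fun i => ?_) fun n => ?_⟩
  · have hr : 0 ≤ r := nonneg_of_abs_le_div_wt (hy 0)
    rw [le_div_iff₀ (wt_pos _ _)]
    calc |P.A y i| * wt P.s i ≤ E * r * wt P.s P.m :=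
          mul_le_mul (hE y r hy i) (wt_mono hs i.2.le) (wt_pos _ _).le
            ((abs_nonneg _).trans (hE y r hy i))
      _ = E * wt P.s P.m * r := by ring
      _ ≤ _ := mul_le_mul_of_nonneg_right (le_max_left _ _) hr
  · have hr : 0 ≤ r := nonneg_of_abs_le_div_wt (hy 0)
    rw [A_tail, neg_mul, neg_mul]
    calc _ ≤ |P.lam P.m| * (q * wt (P.s - P.sL) P.m / wt P.s (P.m + n)) * (E * r)
          + q * r / wt P.s (P.m + n) := by
          refine (abs_add_le _ _).trans (add_le_add ?_ (hq (P.tail y) r (fun n => hy _) n))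
          rw [abs_neg]
          exact abs_mul_le_of_le (abs_mul_le_of_le le_rfl (hw n)) (hE y r hy P.last)
      _ = K * r / wt P.s (P.m + n) := by ring
      _ ≤ _ := by
          have := (wt_pos P.s (P.m + n)).le
          gcongr
          exact le_max_right _ _

end Assumptions

end Data

/-! ### Decay of `A y` -/

namespace Data

variable {P : Data}

variable (P) in
theorem Dcoupling_eq_mul_theta_pow (C : Fin P.m → ℝ) (κ : ℝ) (n : ℕ) :
    P.Dcoupling C κ n = P.Dcoupling C κ 0 * P.theta ^ n := by
  simp only [Dcoupling, pow_zero, mul_one]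

variable (P) in
theorem Dbound_add_mul (C C' : Fin P.m → ℝ) (κ κ' u v : ℝ) (M k : ℕ) :
    P.Dbound (fun j => C j * u + C' j * v) (κ * u + κ' * v) M k
      = P.Dbound C κ M k * u + P.Dbound C' κ' M k * v := by
  have hsum (i : Fin P.m) : ∑ j, |P.Am i j| * (C j * u + C' j * v)
      = (∑ j, |P.Am i j| * C j) * u + (∑ j, |P.Am i j| * C' j) * v := by
    simp only [mul_add, Finset.sum_add_distrib, Finset.sum_mul, mul_assoc]
  have hcoup (n : ℕ) : P.Dcoupling (fun j => C j * u + C' j * v) (κ * u + κ' * v) n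
      = P.Dcoupling C κ n * u + P.Dcoupling C' κ' n * v := by
    unfold Dcoupling
    rw [hsum]
    ring
  unfold Dbound DatM
  simp only [hcoup, hsum]
  split_ifs <;> ring

namespace Assumptions

variable {C2 : ℝ} {k0 : ℕ} (hA : P.Assumptions C2 k0) (hk0 : k0 ≤ P.m)

include hA hk0

theorem abs_tailInv_zero_le {t κ : ℝ} (ht : 0 ≤ t + P.sL) {y : ℕ → ℝ}
    (hy : ∀ n, |y n| ≤ κ / wt t (P.m + n)) :
    |P.tailInv y 0| ≤ P.eta * κ / (P.C1 * (1 - P.theta) * wt (t + P.sL) P.m) := by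
  have hm0 : (P.m : ℝ) ≠ 0 := by exact_mod_cast P.m_pos.ne'
  have hθ := (sub_pos.2 (hA.tailDominant hk0).theta_lt_one).ne'
  have hw := (wt_pos (t + P.sL) P.m).ne'
  have hC1 := hA.C1_pos.ne'
  refine (hA.abs_tailInv_le hk0 ht hy 0).trans_eq ?_
  simp only [geomConv_zero, Nat.cast_zero, add_zero, div_self hm0, Real.one_rpow]
  field_simp
  ring

section Decay

variable {v : ℕ → ℝ} {C : Fin P.m → ℝ} {κ : ℝ} (hs : 0 ≤ P.s) (hsL : 0 ≤ P.sL)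
  (hC : ∀ j : Fin P.m, |v j| ≤ C j) (hκ : ∀ n, |v (P.m + n)| ≤ κ / wt P.s (P.m + n))

include hs hsL hC hκ

theorem abs_A_fin_le_of_decay (i : Fin P.m) :
    |P.A v i| ≤ (∑ j, |P.Am i j| * C j)
      + |P.beta (P.m - 1)| * P.eta * κ / (P.C1 * (1 - P.theta) * wt (P.s + P.sL) P.m)
        * |P.Am i P.last| :=
  (abs_A_fin_le hC (hA.abs_tailInv_zero_le hk0 (y := P.tail v) (by linarith) hκ) i).trans_eq
    (by ring)

theorem abs_A_tail_le_of_decay (n : ℕ) :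
    |P.A v (P.m + n)| ≤ P.Dcoupling C κ n
      + P.eta * κ / (P.C1 * wt (P.s + P.sL) (P.m + n))
        * (geomConv P.theta (fun l => (((P.m : ℝ) + n) / (P.m + l)) ^ (P.s + P.sL)) n
          + P.theta / (1 - P.theta)) := by
  refine ((hA.tailDominant hk0).abs_A_tail_le v
    (hA.abs_A_fin_le_of_decay hk0 hs hsL hC hκ P.last)
    (hA.abs_tailInv_le hk0 (y := P.tail v) (by linarith) hκ n)).trans_eq ?_
  unfold Dcoupling
  ring

theorem Dcoupling_zero_nonneg : 0 ≤ P.Dcoupling C κ 0 := by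
  have hlast := (abs_nonneg _).trans (hA.abs_A_fin_le_of_decay hk0 hs hsL hC hκ P.last)
  have := (hA.tailDominant hk0).eta_pos.le
  calc 0 ≤ _ := mul_nonneg (mul_nonneg hlast this) (by positivity : 0 ≤ |P.lam P.m| / |P.mu P.m|)
    _ = _ := by
        unfold Dcoupling
        ring

theorem abs_A_tail_le_DatM_mul (hm : 2 ≤ P.m) {M n : ℕ} (hMA : P.CondMA M) (hMY : P.CondMY M)
    (hMn : M ≤ n) :
    |P.A v (P.m + n)| ≤ P.DatM C κ M * (wt P.s (P.m + M) / wt P.s (P.m + n)) := by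
  have H := hA.tailDominant hk0
  have hχ := H.geomConv_le_chi (by linarith) hm hMA hMn
  set G := geomConv P.theta (fun l => (((P.m : ℝ) + n) / (P.m + l)) ^ (P.s + P.sL)) n
  set ρ := wt P.s (P.m + M) / wt P.s (P.m + n)
  have hG : 0 ≤ G + P.theta / (1 - P.theta) :=
    add_nonneg (geomConv_nonneg H.theta_pos.le (fun l => by positivity) n)
      (div_nonneg H.theta_pos.le (sub_nonneg.2 H.theta_lt_one.le))
  have hηκ : 0 ≤ P.eta * κ / P.C1 :=
    div_nonneg (mul_nonneg H.eta_pos.le (nonneg_of_abs_le_div_wt (hκ 0))) hA.C1_pos.le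
  have hwt : P.eta * κ / (P.C1 * wt (P.s + P.sL) (P.m + n))
      ≤ P.eta * κ / (P.C1 * wt (P.s + P.sL) (P.m + M)) * ρ := by
    calc _ = P.eta * κ / P.C1 * (wt (P.s + P.sL) (P.m + n))⁻¹ := by ring
      _ ≤ P.eta * κ / P.C1 * ((wt (P.s + P.sL) (P.m + M))⁻¹ * ρ) :=
          mul_le_mul_of_nonneg_left (inv_wt_add_le hsL (Nat.add_le_add_left hMn P.m)) hηκ
      _ = _ := by ring
  calc |P.A v (P.m + n)|
      ≤ P.Dcoupling C κ 0 * P.theta ^ n + P.eta * κ / (P.C1 * wt (P.s + P.sL) (P.m + n))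
        * (G + P.theta / (1 - P.theta)) :=
        P.Dcoupling_eq_mul_theta_pow C κ n ▸ hA.abs_A_tail_le_of_decay hk0 hs hsL hC hκ n
    _ ≤ P.Dcoupling C κ 0 * (P.theta ^ M * ρ)
        + P.eta * κ / (P.C1 * wt (P.s + P.sL) (P.m + M)) * ρ
          * (P.chi M + P.theta / (1 - P.theta)) := by
        have := hA.Dcoupling_zero_nonneg hk0 hs hsL hC hκ
        have hpow : P.theta ^ n ≤ P.theta ^ M * ρ := H.theta_pow_le hs hMY hMn
        refine add_le_add (mul_le_mul_of_nonneg_left hpow this)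
          (mul_le_mul hwt (by gcongr) hG (le_trans ?_ hwt))
        rw [← div_div]
        exact div_nonneg hηκ (wt_pos _ _).le
    _ = P.DatM C κ M * ρ := by
        rw [DatM, P.Dcoupling_eq_mul_theta_pow C κ M]
        ring

theorem abs_A_le_Dbound (hm : 2 ≤ P.m) {M : ℕ} (hMA : P.CondMA M) (hMY : P.CondMY M) (k : ℕ) :
    |P.A v k| ≤ P.Dbound C κ M k := by
  refine forall_fin_or_add P.m (p := fun k => |P.A v k| ≤ P.Dbound C κ M k) (fun i => ?_)
    (fun n => ?_) k
  · rw [Dbound, dif_pos i.2]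
    exact hA.abs_A_fin_le_of_decay hk0 hs hsL hC hκ i
  rw [Dbound, dif_neg (by omega), Nat.add_sub_cancel_left]
  split_ifs with hn hn
  · rw [Nat.cast_add]
    exact hA.abs_A_tail_le_of_decay hk0 hs hsL hC hκ n
  · have := hA.abs_A_tail_le_DatM_mul hk0 hs hsL hC hκ hm hMA hMY hn.ge
    subst hn
    rwa [div_self (wt_pos _ _).ne', mul_one] at this
  · exact hA.abs_A_tail_le_DatM_mul hk0 hs hsL hC hκ hm hMA hMY (by omega)

end Decay

end Assumptions

end Data

/-! ### The defect of `A A†` -/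

namespace Data

variable {P : Data}

theorem tri_m_add_succ (P : Data) (z : ℕ → ℝ) (n : ℕ) :
    P.tri z (P.m + (n + 1)) = P.a (n + 2) * z (P.m + n) + P.b (n + 2) * z (P.m + (n + 1))
      + P.c (n + 2) * z (P.m + (n + 2)) := rfl

theorem tri_m (P : Data) (z : ℕ → ℝ) :
    P.tri z P.m = P.lam P.m * z P.last + (P.b 1 * z P.m + P.c 1 * z (P.m + 1)) := by
  obtain ⟨k, hk⟩ : ∃ k, P.m = k + 1 := ⟨P.m - 1, by have := P.m_pos; omega⟩
  change P.tri z P.m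
    = P.lam P.m * z (P.m - 1) + (P.mu P.m * z P.m + P.beta P.m * z (P.m + 1))
  rw [hk, ← add_assoc]
  rfl

theorem tail_Adag (P : Data) (z : ℕ → ℝ) (n : ℕ) :
    P.tail (P.Adag z) n = P.tri z (P.m + n) := by
  simp [tail, Adag]

theorem Adag_fin (P : Data) (z : ℕ → ℝ) (i : Fin P.m) :
    P.Adag z i = (∑ j, P.D i j * z j) + if i = P.last then P.beta (P.m - 1) * z P.m else 0 := by
  have h : ((i : ℕ) = P.m - 1) ↔ i = P.last := by
    rw [Fin.ext_iff]
    rfl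
  simp [Adag, h]

theorem sum_Ktilde_mul (P : Data) (z : ℕ → ℝ) (i : Fin P.m) :
    ∑ j, P.Ktilde i j * z j = P.Adag z i - if i = P.last then
      P.beta (P.m - 1) * z P.m + P.beta (P.m - 1) * P.lam P.m * P.wtilde * z P.last else 0 := by
  have hsingle : ∑ j, P.beta (P.m - 1) * P.lam P.m * Matrix.single P.last P.last P.wtilde i j * z j
      = if i = P.last then P.beta (P.m - 1) * P.lam P.m * P.wtilde * z P.last else 0 := by
    rw [Finset.sum_eq_single P.last
      (fun j _ hj => by rw [Matrix.single_apply_of_col_ne _ _ hj.symm, mul_zero, zero_mul])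
      (fun h => absurd (Finset.mem_univ _) h)]
    split_ifs with h
    · rw [h, Matrix.single_apply_same]
    · rw [Matrix.single_apply_of_row_ne (Ne.symm h), mul_zero, zero_mul]
  simp only [Ktilde, Matrix.sub_apply, Matrix.smul_apply, smul_eq_mul, sub_mul,
    Finset.sum_sub_distrib]
  rw [hsingle, Adag_fin]
  split_ifs <;> ring

namespace TailDominant

variable (H : P.TailDominant)

include H

theorem abs_tridiag_div_piv_le {y z : ℕ → ℝ} {B : ℝ} (hz : ∀ n, |z n| ≤ B)
    (hzero : y 0 = P.b 1 * z 0 + P.c 1 * z 1)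
    (hsucc : ∀ n, y (n + 1)
      = P.a (n + 2) * z n + P.b (n + 2) * z (n + 1) + P.c (n + 2) * z (n + 2)) (n : ℕ) :
    |y n / P.piv n| ≤ P.theta * B + 1 / P.gamma * B + P.theta * B := by
  have hb (n : ℕ) : |P.b (n + 1) / P.piv n| ≤ 1 / P.gamma := by
    rw [abs_div, div_le_div_iff₀ (abs_pos.2 (H.piv_ne_zero n)) P.gamma_pos, one_mul, mul_comm]
    exact H.gamma_mul_le_abs_piv n
  have hbc (n : ℕ) : |(P.b (n + 1) * z n + P.c (n + 1) * z (n + 1)) / P.piv n|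
      ≤ 1 / P.gamma * B + P.theta * B := by
    rw [add_div, mul_div_right_comm, mul_div_right_comm]
    exact (abs_add_le _ _).trans (add_le_add (abs_mul_le_of_le (hb n) (hz n))
      (abs_mul_le_of_le (H.abs_c_div_piv_le n) (hz (n + 1))))
  cases n with
  | zero =>
    have hB : 0 ≤ P.theta * B := mul_nonneg H.theta_pos.le ((abs_nonneg _).trans (hz 0))
    rw [hzero]
    linarith [hbc 0]
  | succ n =>
    rw [hsucc, add_assoc, add_div, mul_div_right_comm, add_assoc]
    exact (abs_add_le _ _).trans (add_le_add
      (abs_mul_le_of_le (H.abs_a_div_piv_le (n + 1)) (hz n)) (hbc (n + 1)))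

theorem tailInv_tail_Adag {z : ℕ → ℝ} {B : ℝ} (hz : ∀ n, |z n| ≤ B) :
    P.tailInv (P.tail (P.Adag z)) = (P.lam P.m * z P.last) • P.w + P.tail z := by
  set e : ℕ → ℝ := Pi.single 0 1 with he
  set y : ℕ → ℝ := P.tail (P.Adag z) - (P.lam P.m * z P.last) • e with hy
  have hzero : y 0 = P.b 1 * P.tail z 0 + P.c 1 * P.tail z 1 := by
    simp only [hy, he, Pi.sub_apply, Pi.smul_apply, Pi.single_eq_same, smul_eq_mul, mul_one,
      tail_Adag, add_zero, tri_m]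
    exact add_sub_cancel_left _ _
  have hsucc (n : ℕ) : y (n + 1) = P.a (n + 2) * P.tail z n + P.b (n + 2) * P.tail z (n + 1)
      + P.c (n + 2) * P.tail z (n + 2) := by
    simp only [hy, he, Pi.sub_apply, Pi.smul_apply, Pi.single_eq_of_ne n.succ_ne_zero, smul_zero,
      sub_zero, tail_Adag, tri_m_add_succ]
    rfl
  have htail (n : ℕ) : |P.tail z n| ≤ B := hz (P.m + n)
  have hsingle (n : ℕ) : |e n / P.piv n| ≤ 1 / |P.b 1| :=
    (P.abs_single_div_piv_le n).trans (P.single_inv_le n)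
  have hsmul (n : ℕ) : |((P.lam P.m * z P.last) • e) n / P.piv n|
      ≤ |P.lam P.m * z P.last| * (1 / |P.b 1|) := by
    rw [Pi.smul_apply, smul_eq_mul, mul_div_assoc]
    exact abs_mul_le_of_le le_rfl (hsingle n)
  calc P.tailInv (P.tail (P.Adag z))
      = P.tailInv ((P.lam P.m * z P.last) • e + y) := by rw [hy, add_sub_cancel]
    _ = (P.lam P.m * z P.last) • P.tailInv e + P.tailInv y := by
        rw [H.tailInv_add hsmul (H.abs_tridiag_div_piv_le htail hzero hsucc),
          H.tailInv_smul _ hsingle]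
    _ = (P.lam P.m * z P.last) • P.w + P.tail z := by rw [H.tailInv_tridiag htail hzero hsucc]; rfl

theorem sub_A_Adag_fin {z : ℕ → ℝ} {B : ℝ} (hz : ∀ n, |z n| ≤ B) (i : Fin P.m) :
    z i - P.A (P.Adag z) i = (∑ j, (1 - P.Am * P.Ktilde) i j * z j)
      + P.beta (P.m - 1) * P.lam P.m * (P.w 0 - P.wtilde) * P.Am i P.last * z P.last := by
  have hmul : ∑ j, (1 - P.Am * P.Ktilde) i j * z j
      = z i - ∑ j, P.Am i j * ∑ l, P.Ktilde j l * z l := by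
    have h := congrFun (Matrix.sub_mulVec 1 (P.Am * P.Ktilde) fun j : Fin P.m => z j) i
    rwa [Matrix.one_mulVec, ← Matrix.mulVec_mulVec] at h
  have hinv : P.tailInv (P.tail (P.Adag z)) 0 = P.lam P.m * z P.last * P.w 0 + z P.m := by
    rw [H.tailInv_tail_Adag hz]
    rfl
  rw [hmul, A_fin, hinv]
  simp only [sum_Ktilde_mul, mul_sub, Finset.sum_sub_distrib, mul_ite, mul_zero,
    Finset.sum_ite_eq', Finset.mem_univ, if_true]
  ring

theorem sub_A_Adag_tail {z : ℕ → ℝ} {B : ℝ} (hz : ∀ n, |z n| ≤ B) (n : ℕ) :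
    z (P.m + n) - P.A (P.Adag z) (P.m + n)
      = -P.lam P.m * P.w n * (z P.last - P.A (P.Adag z) P.last) := by
  have hinv : P.tailInv (P.tail (P.Adag z)) n = P.lam P.m * z P.last * P.w n + z (P.m + n) := by
    rw [H.tailInv_tail_Adag hz]
    rfl
  rw [A_tail, hinv]
  ring

section Decay

variable (hs : 0 ≤ P.s) {z : ℕ → ℝ} {r : ℝ} (hz : ∀ k, |z k| ≤ r / wt P.s k)

include hs hz

theorem abs_sub_A_Adag_fin_le (i : Fin P.m) :
    |z i - P.A (P.Adag z) i| ≤ (P.defect i + P.truncErr * |P.Am i P.last|) * r := by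
  have hw : |P.w 0 - P.wtilde| ≤ P.theta ^ (2 * P.L) / (|P.mu P.m| * (1 - P.theta ^ 2)) :=
    H.abs_w_zero_sub_wtilde_le
  rw [H.sub_A_Adag_fin (abs_le_of_abs_le_div_wt hs hz), add_mul]
  refine (abs_add_le _ _).trans (add_le_add ?_ ?_)
  · rw [defect, Finset.sum_mul]
    refine (Finset.abs_sum_le_sum_abs _ _).trans (Finset.sum_le_sum fun j _ => ?_)
    rw [mul_assoc, one_div_mul_eq_div]
    exact abs_mul_le_of_le le_rfl (hz j)
  · have hlast : |z P.last| ≤ r / wt P.s (P.m - 1) := hz (P.m - 1)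
    calc |P.beta (P.m - 1) * P.lam P.m * (P.w 0 - P.wtilde) * P.Am i P.last * z P.last|
        ≤ |P.beta (P.m - 1)| * |P.lam P.m|
          * (P.theta ^ (2 * P.L) / (|P.mu P.m| * (1 - P.theta ^ 2))) * |P.Am i P.last|
          * (r / wt P.s (P.m - 1)) := by
          refine abs_mul_le_of_le ?_ hlast
          rw [abs_mul, abs_mul, abs_mul]
          gcongr
      _ = P.truncErr * |P.Am i P.last| * r := by
          simp only [truncErr, div_eq_mul_inv, mul_inv]
          ring

theorem abs_sub_A_Adag_tail_le (n : ℕ) :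
    |z (P.m + n) - P.A (P.Adag z) (P.m + n)| ≤ P.Z1tail r n := by
  have hw : |P.w n| ≤ P.eta * P.theta ^ n / |P.mu P.m| := H.abs_w_le n
  rw [H.sub_A_Adag_tail (abs_le_of_abs_le_div_wt hs hz), neg_mul, neg_mul, abs_neg]
  refine (abs_mul_le_of_le (abs_mul_le_of_le le_rfl hw)
    (H.abs_sub_A_Adag_fin_le hs hz P.last)).trans_eq ?_
  rw [Z1tail]
  ring

theorem Z1tail_le {M n : ℕ} (hMY : P.CondMY M) (hn : M ≤ n) :
    P.Z1tail r n ≤ P.Z1tail r M * (wt P.s (P.m + M) / wt P.s (P.m + n)) := by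
  have hcoef : 0 ≤ (P.defect P.last + P.truncErr * |P.Am P.last P.last|) * r
      * (P.eta * (|P.lam P.m| / |P.mu P.m|)) :=
    mul_nonneg ((abs_nonneg _).trans (H.abs_sub_A_Adag_fin_le hs hz P.last))
      (mul_nonneg H.eta_pos.le (by positivity))
  refine (Eq.trans_le ?_ (mul_le_mul_of_nonneg_left (H.theta_pow_le hs hMY hn) hcoef)).trans_eq ?_
  all_goals
    simp only [Z1tail]
    ring

theorem abs_sub_A_Adag_le {M : ℕ} (hMY : P.CondMY M) (k : ℕ) :
    |z k - P.A (P.Adag z) k| ≤ P.Z1 M r k := by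
  refine forall_fin_or_add P.m (p := fun k => |z k - P.A (P.Adag z) k| ≤ P.Z1 M r k)
    (fun i => ?_) (fun n => ?_) k
  · rw [Z1, dif_pos i.2]
    exact H.abs_sub_A_Adag_fin_le hs hz i
  rw [Z1, dif_neg (by omega), Nat.add_sub_cancel_left]
  split_ifs with h
  · exact H.abs_sub_A_Adag_tail_le hs hz n
  · exact (H.abs_sub_A_Adag_tail_le hs hz n).trans (H.Z1tail_le hs hz hMY (not_le.1 h).le)

end Decay

end TailDominant

end Data

/-! ### The derivatives of `f` and `T` -/

namespace Data

variable {P : Data}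

theorem tri_add (P : Data) (x y : ℕ → ℝ) : P.tri (x + y) = P.tri x + P.tri y := by
  funext k
  cases k <;> simp only [tri, Pi.add_apply] <;> ring

theorem tri_smul (P : Data) (r : ℝ) (x : ℕ → ℝ) : P.tri (r • x) = r • P.tri x := by
  funext k
  cases k <;> simp only [tri, Pi.smul_apply, smul_eq_mul] <;> ring

theorem tri_apply_of_forall_lt (P : Data) {x : ℕ → ℝ} (hx : ∀ k < P.m, x k = 0) (i : Fin P.m) :
    P.tri x i = if i = P.last then P.beta (P.m - 1) * x P.m else 0 := by
  obtain ⟨k, hk⟩ := i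
  have hnext : P.tri x k = P.beta k * x (k + 1) := by
    cases k with
    | zero => rw [tri, hx 0 hk, mul_zero, zero_add]
    | succ k => rw [tri, hx (k + 1) hk, hx k (by omega), mul_zero, mul_zero, zero_add, zero_add]
  rw [hnext]
  split_ifs with h
  · obtain rfl : k = P.m - 1 := congrArg Fin.val h
    rw [Nat.sub_add_cancel P.m_pos]
  · have : k ≠ P.m - 1 := fun h' => h (Fin.ext h')
    rw [hx (k + 1) (by omega), mul_zero]

/-- The finite part `x_F = (x_0, …, x_{m-1})`. -/
def head (P : Data) (x : ℕ → ℝ) (i : Fin P.m) : ℝ := x i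

theorem pad_of_le (P : Data) (x : Fin P.m → ℝ) {k : ℕ} (hk : P.m ≤ k) : P.pad x k = 0 :=
  dif_neg (not_lt.2 hk)

theorem sub_pad_head_of_lt (P : Data) (x : ℕ → ℝ) {k : ℕ} (hk : k < P.m) :
    (x - P.pad (P.head x)) k = 0 := by
  simp [pad, head, hk]

theorem sub_pad_head_of_le (P : Data) (x : ℕ → ℝ) {k : ℕ} (hk : P.m ≤ k) :
    (x - P.pad (P.head x)) k = x k := by
  rw [Pi.sub_apply, P.pad_of_le _ hk, sub_zero]

/-- `x_F ↦ (x_F, 0, 0, …)` as a continuous linear map into `Ω^s`. -/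
noncomputable def padL (P : Data) : (Fin P.m → ℝ) →L[ℝ] Omega P.s :=
  LinearMap.toContinuousLinearMap
    { toFun := fun x => Omega.mk (P.pad x) (P.memOmega_pad P.s x)
      map_add' := fun x y => Omega.ext fun k => by
        simp only [Omega.seq_mk, Omega.seq_add, Pi.add_apply, pad]
        split_ifs <;> simp
      map_smul' := fun r x => Omega.ext fun k => by
        simp only [Omega.seq_mk, Omega.seq_smul, Pi.smul_apply, pad, RingHom.id_apply]
        split_ifs <;> simp }

theorem conv_pad_sub_pad_head (P : Data) (x : Fin P.m → ℝ) (z : ℕ → ℝ) (i : Fin P.m) :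
    conv (P.pad x) (z - P.pad (P.head z)) i
      = ∑ l ∈ Finset.Icc (P.m - i) (P.m - 1), P.pad x l * z (i + l) := by
  have hi := i.2
  have hinj : Function.Injective fun l : ℕ => -(l : ℤ) :=
    neg_injective.comp Nat.cast_injective
  unfold conv
  rw [tsum_eq_sum (s := (Finset.Icc (P.m - i) (P.m - 1)).image fun l : ℕ => -(l : ℤ)),
    Finset.sum_image hinj.injOn]
  · refine Finset.sum_congr rfl fun l hl => ?_
    rw [Finset.mem_Icc] at hl
    rw [show (-(l : ℤ)).natAbs = l by omega,
      show (((i : ℕ) : ℤ) - -(l : ℤ)).natAbs = i + l by omega,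
      P.sub_pad_head_of_le z (by omega)]
  · intro j hj
    rcases lt_or_ge (((i : ℕ) : ℤ) - j).natAbs P.m with hsnd | hsnd
    · rw [P.sub_pad_head_of_lt z hsnd, mul_zero]
    rcases lt_or_ge j.natAbs P.m with hfst | hfst
    · refine absurd (Finset.mem_image.2 ⟨j.natAbs, Finset.mem_Icc.2 ?_, ?_⟩) hj <;> omega
    · rw [P.pad_of_le x hfst, zero_mul]

theorem abs_conv_pad_sub_pad_head_le (P : Data) (x : Fin P.m → ℝ) {z : ℕ → ℝ} {r : ℝ}
    (hz : ∀ k, |z k| ≤ r / wt P.s k) (i : Fin P.m) :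
    |conv (P.pad x) (z - P.pad (P.head z)) i|
      ≤ (∑ l ∈ Finset.Icc (P.m - i) (P.m - 1), |P.pad x l| / wt P.s (i + l)) * r := by
  rw [conv_pad_sub_pad_head, Finset.sum_mul]
  refine (Finset.abs_sum_le_sum_abs _ _).trans (Finset.sum_le_sum fun l _ => ?_)
  rw [div_mul_eq_mul_div, mul_div_assoc]
  exact abs_mul_le_of_le le_rfl (hz _)

namespace Assumptions

variable {C2 : ℝ} {k0 : ℕ} (hA : P.Assumptions C2 k0)

include hA

theorem abs_tri_le (hs : 0 ≤ P.s) {x : ℕ → ℝ} {r : ℝ} (hx : ∀ k, |x k| ≤ r / wt P.s k) (k : ℕ) :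
    |P.tri x k| ≤ C2 * (2 ^ P.s + 2) * r / wt (P.s - P.sL) k := by
  have hr : 0 ≤ r := nonneg_of_abs_le_div_wt (hx 0)
  have hC2 : 0 ≤ C2 := hA.C1_pos.le.trans hA.C1_le_C2
  have hmu (k : ℕ) : |P.mu k * x k| ≤ C2 * (1 * r) / wt (P.s - P.sL) k :=
    abs_mul_le_div_wt (hA.mu_le k) (hx k) (one_mul _).ge
  have hbeta (k : ℕ) : |P.beta k * x (k + 1)| ≤ C2 * (1 * r) / wt (P.s - P.sL) k :=
    abs_mul_le_div_wt (hA.beta_le k) (hx (k + 1)) ((wt_mono hs k.le_succ).trans (one_mul _).ge)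
  cases k with
  | zero =>
    refine (abs_add_le _ _).trans ((add_le_add (hmu 0) (hbeta 0)).trans ?_)
    rw [← add_div, div_le_div_iff_of_pos_right (wt_pos _ _)]
    have : 0 ≤ C2 * (2 ^ P.s * r) := by positivity
    linarith
  | succ k =>
    have hlam := abs_mul_le_div_wt (hA.lam_le (k + 1)) (hx k) (wt_succ_le hs k)
    refine (abs_add_three _ _ _).trans
      ((add_le_add_three hlam (hmu (k + 1)) (hbeta (k + 1))).trans_eq ?_)
    ring

/-- The tridiagonal operator `𝓛` as a continuous linear map `Ω^s → Ω^{s - s_L}`. -/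
noncomputable def triL (hs : 0 ≤ P.s) : Omega P.s →L[ℝ] Omega (P.s - P.sL) :=
  Omega.clm
    { toFun := fun x => P.tri x.seq
      map_add' := fun x y => P.tri_add x.seq y.seq
      map_smul' := fun r x => P.tri_smul r x.seq } (C2 * (2 ^ P.s + 2))
    fun _ => hA.abs_tri_le hs (Omega.abs_seq_le le_rfl)

theorem memOmega_f (hs : 2 ≤ P.s) (hsL : 0 ≤ P.sL) (hg : MemOmega (P.s - P.sL) P.g)
    (x : Omega P.s) : MemOmega (P.s - P.sL) (P.f x.seq) :=
  (hA.triL (by linarith) x).mem.add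
    ((((memOmega_conv hs x x).smul P.sigma).of_exponent_le (by linarith)).add hg)

/-- The derivative `z ↦ 𝓛 z + 2 σ (x * z)` of `f` at `x`. -/
noncomputable def derivF (hs : 2 ≤ P.s) (hsL : 0 ≤ P.sL) (x : Omega P.s) :
    Omega P.s →L[ℝ] Omega (P.s - P.sL) :=
  hA.triL (by linarith) + (Omega.incl (by linarith)).comp ((2 * P.sigma) • convL hs x)

theorem derivF_seq (hs : 2 ≤ P.s) (hsL : 0 ≤ P.sL) (x z : Omega P.s) :
    (hA.derivF hs hsL x z).seq = P.tri z.seq + (2 * P.sigma) • conv x.seq z.seq := rfl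

theorem hasFDerivAt_f (hs : 2 ≤ P.s) (hsL : 0 ≤ P.sL) (hg : MemOmega (P.s - P.sL) P.g)
    (x : Omega P.s) :
    HasFDerivAt (fun x : Omega P.s => Omega.mk (P.f x.seq) (hA.memOmega_f hs hsL hg x))
      (hA.derivF hs hsL x) x := by
  have hle : P.s - P.sL ≤ P.s := by linarith
  have hsquare : HasFDerivAt (fun x => P.sigma • convL hs x x) ((2 * P.sigma) • convL hs x) x := by
    refine (((convL hs).hasFDerivAt.clm_apply (hasFDerivAt_id x)).const_smul
      P.sigma).congr_fderiv ?_
    rw [convL_flip, ContinuousLinearMap.comp_id, id, ← two_smul ℝ, smul_smul, mul_comm P.sigma]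
  exact (hA.triL (by linarith)).hasFDerivAt.add
    (((Omega.incl hle).hasFDerivAt.comp x hsquare).add_const (Omega.mk P.g hg))

theorem hasFDerivAt_fm (hs : 2 ≤ P.s) (hsL : 0 ≤ P.sL) (hg : MemOmega (P.s - P.sL) P.g) :
    HasFDerivAt P.fm (ContinuousLinearMap.pi fun i : Fin P.m =>
      (Omega.coord (P.s - P.sL) i).comp ((hA.derivF hs hsL P.xbarOmega).comp P.padL)) P.xbar :=
  hasFDerivAt_pi.2 fun i => (Omega.coord (P.s - P.sL) i).hasFDerivAt.comp P.xbar
    (HasFDerivAt.comp P.xbar (hA.hasFDerivAt_f hs hsL hg (P.padL P.xbar)) P.padL.hasFDerivAt)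

theorem sum_D_mul (hs : 2 ≤ P.s) (hsL : 0 ≤ P.sL) (hg : MemOmega (P.s - P.sL) P.g)
    (v : Fin P.m → ℝ) (i : Fin P.m) :
    ∑ j, P.D i j * v j = P.tri (P.pad v) i + 2 * P.sigma * conv (P.pad P.xbar) (P.pad v) i := by
  have hmulVec : ∑ j, P.D i j * v j = fderiv ℝ P.fm P.xbar v i := congrFun
    (LinearMap.toMatrix'_mulVec (fderiv ℝ P.fm P.xbar : (Fin P.m → ℝ) →ₗ[ℝ] (Fin P.m → ℝ)) v) i
  rw [hmulVec, (hA.hasFDerivAt_fm hs hsL hg).fderiv]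
  rfl

theorem Adag_fin_eq (hs : 2 ≤ P.s) (hsL : 0 ≤ P.sL) (hg : MemOmega (P.s - P.sL) P.g)
    (z : ℕ → ℝ) (i : Fin P.m) :
    P.Adag z i
      = P.tri z i + 2 * P.sigma * conv (P.pad P.xbar) (P.pad (P.head z)) i := by
  have htri := congrFun (P.tri_add (P.pad (P.head z)) (z - P.pad (P.head z))) i
  rw [add_sub_cancel, Pi.add_apply, P.tri_apply_of_forall_lt fun k => P.sub_pad_head_of_lt z,
    P.sub_pad_head_of_le z le_rfl] at htri
  have hD : ∑ j, P.D i j * z j = _ := hA.sum_D_mul hs hsL hg (P.head z) i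
  rw [Adag_fin, hD, htri]
  ring

theorem memOmega_Adag (hs : 0 ≤ P.s) (z : Omega P.s) :
    MemOmega (P.s - P.sL) (P.Adag z.seq) := by
  have hAdag : P.Adag z.seq = P.tri z.seq + P.pad (P.head (P.Adag z.seq - P.tri z.seq)) := by
    refine funext (forall_fin_or_add P.m (fun i => ?_) fun n => ?_)
    · simp [pad, head]
    · rw [Pi.add_apply, P.pad_of_le _ (Nat.le_add_right _ _), add_zero]
      exact P.tail_Adag z.seq n
  rw [hAdag]
  exact (hA.triL hs z).mem.add (P.memOmega_pad _ _)

end Assumptions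

end Data

namespace Data

variable {P : Data}

namespace Assumptions

variable {C2 : ℝ} {k0 : ℕ} (hA : P.Assumptions C2 k0)

include hA

theorem derivF_sub_Adag_fin (hs : 2 ≤ P.s) (hsL : 0 ≤ P.sL) (hg : MemOmega (P.s - P.sL) P.g)
    (y z : Omega P.s) (i : Fin P.m) :
    ((hA.derivF hs hsL (P.xbarOmega + y) z).seq - P.Adag z.seq) i
      = 2 * P.sigma * (conv (P.pad P.xbar) (z.seq - P.pad (P.head z.seq)) i
        + conv y.seq z.seq i) := by
  have hleft : conv (P.xbarOmega + y).seq z.seq i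
      = conv (P.pad P.xbar) z.seq i + conv y.seq z.seq i :=
    congrFun (conv_add_left (by linarith) P.xbarOmega.mem y.mem z.mem) i
  have hright : conv (P.pad P.xbar) z.seq i = conv (P.pad P.xbar) (P.pad (P.head z.seq)) i
      + conv (P.pad P.xbar) (z.seq - P.pad (P.head z.seq)) i := by
    have hpad := P.memOmega_pad P.s (P.head z.seq)
    have hsplit := conv_add_right (by linarith) (P.memOmega_pad P.s P.xbar) hpad (z.mem.sub hpad)
    rw [add_sub_cancel] at hsplit
    exact congrFun hsplit i
  rw [derivF_seq, Pi.sub_apply, Pi.add_apply, Pi.smul_apply, smul_eq_mul, hleft, hright,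
    hA.Adag_fin_eq hs hsL hg]
  ring

theorem derivF_sub_Adag_tail (hs : 2 ≤ P.s) (hsL : 0 ≤ P.sL) (y z : Omega P.s) (n : ℕ) :
    ((hA.derivF hs hsL (P.xbarOmega + y) z).seq - P.Adag z.seq) (P.m + n)
      = 2 * P.sigma * (conv (P.pad P.xbar) z.seq (P.m + n) + conv y.seq z.seq (P.m + n)) := by
  have hleft : conv (P.xbarOmega + y).seq z.seq (P.m + n)
      = conv (P.pad P.xbar) z.seq (P.m + n) + conv y.seq z.seq (P.m + n) :=
    congrFun (conv_add_left (by linarith) P.xbarOmega.mem y.mem z.mem) _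
  have hAdag : P.Adag z.seq (P.m + n) = P.tri z.seq (P.m + n) := P.tail_Adag z.seq n
  rw [derivF_seq, Pi.sub_apply, Pi.add_apply, Pi.smul_apply, smul_eq_mul, hleft, hAdag]
  ring

section Bounds

variable (hs : 2 ≤ P.s) (hsL : 0 ≤ P.sL) (hm : 6 ≤ P.m) (hN : 1 ≤ P.N)
  {y z : Omega P.s} {r : ℝ} (hy : ‖y‖ ≤ r) (hz : ‖z‖ ≤ r)

include hm hN hy hz

theorem abs_derivF_sub_Adag_fin_le (hg : MemOmega (P.s - P.sL) P.g) (i : Fin P.m) :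
    |((hA.derivF hs hsL (P.xbarOmega + y) z).seq - P.Adag z.seq) i|
      ≤ P.C1F i * r + P.C2F i * r ^ 2 := by
  have hxz := P.abs_conv_pad_sub_pad_head_le P.xbar (Omega.abs_seq_le hz) i
  have hyz := abs_conv_le hs hm hN (Omega.abs_seq_le hy) (Omega.abs_seq_le hz) i
  rw [hA.derivF_sub_Adag_fin hs hsL hg, mul_assoc, abs_mul, abs_two]
  refine (mul_le_mul_of_nonneg_left (abs_mul_le_of_le le_rfl
    ((abs_add_le _ _).trans (add_le_add hxz hyz))) zero_le_two).trans_eq ?_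
  rw [C1F, C2F]
  ring

theorem abs_derivF_sub_Adag_tail_le (n : ℕ) :
    |((hA.derivF hs hsL (P.xbarOmega + y) z).seq - P.Adag z.seq) (P.m + n)|
      ≤ (2 * |P.sigma| * alpha P.s P.m P.N P.m * omegaNorm P.s (P.pad P.xbar) * r
        + 2 * |P.sigma| * alpha P.s P.m P.N P.m * r ^ 2) / wt P.s (P.m + n) := by
  have halpha := alpha_of_le (s := P.s) (N := P.N) P.m_pos (Nat.le_add_right P.m n)
  have hxz := abs_conv_le hs hm hN (P.memOmega_pad P.s P.xbar).abs_le (Omega.abs_seq_le hz)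
    (P.m + n)
  have hyz := abs_conv_le hs hm hN (Omega.abs_seq_le hy) (Omega.abs_seq_le hz) (P.m + n)
  rw [hA.derivF_sub_Adag_tail hs hsL, mul_assoc, abs_mul, abs_two]
  refine (mul_le_mul_of_nonneg_left (abs_mul_le_of_le le_rfl
    ((abs_add_le _ _).trans (add_le_add hxz hyz))) zero_le_two).trans_eq ?_
  rw [halpha]
  ring

theorem abs_A_derivF_sub_Adag_le (hk0 : k0 ≤ P.m) (hg : MemOmega (P.s - P.sL) P.g) {M : ℕ}
    (hMA : P.CondMA M) (hMY : P.CondMY M) (k : ℕ) :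
    |P.A ((hA.derivF hs hsL (P.xbarOmega + y) z).seq - P.Adag z.seq) k| ≤ P.Z2 M r k := by
  rw [Z2, D1, D2, ← Dbound_add_mul]
  exact hA.abs_A_le_Dbound hk0 (by linarith) hsL
    (hA.abs_derivF_sub_Adag_fin_le hs hsL hm hN hy hz hg)
    (hA.abs_derivF_sub_Adag_tail_le hs hsL hm hN hy hz) (by omega) hMA hMY k

end Bounds

variable (hk0 : k0 ≤ P.m)

include hk0

/-- The operator `A` as a continuous linear map `Ω^{s - s_L} → Ω^s`. -/
noncomputable def AL (hs : 0 ≤ P.s) : Omega (P.s - P.sL) →L[ℝ] Omega P.s :=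
  Omega.clm
    { toFun := fun y => P.A y.seq
      map_add' := fun y z => hA.A_add hk0 hs y.mem z.mem
      map_smul' := fun r y => hA.A_smul hk0 hs r y.mem }
    (hA.exists_abs_A_le hk0 hs).choose
    fun y => (hA.exists_abs_A_le hk0 hs).choose_spec y.seq ‖y‖ (Omega.abs_seq_le le_rfl)

theorem memOmega_T (hs : 2 ≤ P.s) (hsL : 0 ≤ P.sL) (hg : MemOmega (P.s - P.sL) P.g)
    (x : Omega P.s) : MemOmega P.s (P.T x.seq) :=
  x.mem.sub (hA.AL hk0 (by linarith) (Omega.mk (P.f x.seq) (hA.memOmega_f hs hsL hg x))).mem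

theorem hasFDerivAt_T (hs : 2 ≤ P.s) (hsL : 0 ≤ P.sL) (hg : MemOmega (P.s - P.sL) P.g)
    (x : Omega P.s) :
    HasFDerivAt (fun x : Omega P.s => Omega.mk (P.T x.seq) (hA.memOmega_T hk0 hs hsL hg x))
      (ContinuousLinearMap.id ℝ (Omega P.s)
        - (hA.AL hk0 (by linarith)).comp (hA.derivF hs hsL x)) x :=
  (hasFDerivAt_id x).sub
    ((hA.AL hk0 (by linarith)).hasFDerivAt.comp x (hA.hasFDerivAt_f hs hsL hg x))

theorem abs_sub_A_le (hs : 0 ≤ P.s) {y : ℕ → ℝ} (hy : MemOmega (P.s - P.sL) y) (z : Omega P.s)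
    (k : ℕ) :
    |z.seq k - P.A y k| ≤ |z.seq k - P.A (P.Adag z.seq) k| + |P.A (y - P.Adag z.seq) k| := by
  have hAdag := hA.memOmega_Adag hs z
  have hadd := congrFun (hA.A_add hk0 hs (hy.sub hAdag) hAdag) k
  rw [sub_add_cancel, Pi.add_apply] at hadd
  rw [hadd, sub_add_eq_sub_sub_swap]
  exact abs_sub _ _

end Assumptions

end Data

end TridiagNewton

theorem mainTheorem4_general (P : TridiagNewton.Data) (C2 : ℝ) (k0 : ℕ)
    (hs : 2 ≤ P.s) (hsL : 0 ≤ P.sL) (hg : TridiagNewton.MemOmega (P.s - P.sL) P.g)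
    (hA : P.Assumptions C2 k0) (hk0 : k0 ≤ P.m) (hm : 6 ≤ P.m) (hN : 1 ≤ P.N)
    (M : ℕ) (hMA : P.CondMA M) (hMY : P.CondMY M) :
    ∃ (hf : ∀ x : TridiagNewton.Omega P.s, TridiagNewton.MemOmega (P.s - P.sL) (P.f x.seq))
      (hT : ∀ x : TridiagNewton.Omega P.s, TridiagNewton.MemOmega P.s (P.T x.seq)),
      Differentiable ℝ
        (fun x : TridiagNewton.Omega P.s => TridiagNewton.Omega.mk (P.f x.seq) (hf x)) ∧
      Differentiable ℝ
        (fun x : TridiagNewton.Omega P.s => TridiagNewton.Omega.mk (P.T x.seq) (hT x)) ∧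
      ∀ r : ℝ, ∀ y ∈ Metric.closedBall (0 : TridiagNewton.Omega P.s) r,
        ∀ z ∈ Metric.closedBall (0 : TridiagNewton.Omega P.s) r, ∀ k : ℕ,
          |z.seq k - P.A (P.Adag z.seq) k| ≤ P.Z1 M r k ∧
          |P.A ((fderiv ℝ
              (fun x : TridiagNewton.Omega P.s => TridiagNewton.Omega.mk (P.f x.seq) (hf x))
              (P.xbarOmega + y) z).seq - P.Adag z.seq) k| ≤ P.Z2 M r k ∧
          |(fderiv ℝ
              (fun x : TridiagNewton.Omega P.s => TridiagNewton.Omega.mk (P.T x.seq) (hT x))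
              (P.xbarOmega + y) z).seq k| ≤ P.Z M r k := by
  have hs0 : 0 ≤ P.s := by linarith
  have hf' := hA.hasFDerivAt_f hs hsL hg
  have hT' := hA.hasFDerivAt_T hk0 hs hsL hg
  refine ⟨hA.memOmega_f hs hsL hg, hA.memOmega_T hk0 hs hsL hg, fun x => (hf' x).differentiableAt,
    fun x => (hT' x).differentiableAt, fun r y hy z hz k => ?_⟩
  rw [mem_closedBall_zero_iff] at hy hz
  rw [(hf' _).fderiv, (hT' _).fderiv]
  have hZ1 := (hA.tailDominant hk0).abs_sub_A_Adag_le hs0 (TridiagNewton.Omega.abs_seq_le hz) hMY k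
  have hZ2 := hA.abs_A_derivF_sub_Adag_le hs hsL hm hN hy hz hk0 hg hMA hMY k
  exact ⟨hZ1, hZ2, (hA.abs_sub_A_le hk0 hs0 (Subtype.prop _) z k).trans (add_le_add hZ1 hZ2)⟩

theorem mainTheorem4 (P : TridiagNewton.Data) (C2 : ℝ) (k0 : ℕ)
    (hs : 2 ≤ P.s) (hsL : 0 < P.sL) (hg : TridiagNewton.MemOmega P.s P.g)
    (hA : P.Assumptions C2 k0) (hk0 : k0 ≤ P.m) (hm : 6 ≤ P.m) (hN : 1 ≤ P.N)
    (M : ℕ) (hMA : P.CondMA M) (hMY : P.CondMY M) :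
    ∃ (hf : ∀ x : TridiagNewton.Omega P.s, TridiagNewton.MemOmega (P.s - P.sL) (P.f x.seq))
      (hT : ∀ x : TridiagNewton.Omega P.s, TridiagNewton.MemOmega P.s (P.T x.seq)),
      Differentiable ℝ (fun x : TridiagNewton.Omega P.s => TridiagNewton.Omega.mk (P.f x.seq) (hf x)) ∧
      Differentiable ℝ (fun x : TridiagNewton.Omega P.s => TridiagNewton.Omega.mk (P.T x.seq) (hT x)) ∧
      ∀ r : ℝ, 0 < r → ∀ y ∈ Metric.closedBall (0 : TridiagNewton.Omega P.s) r,
        ∀ z ∈ Metric.closedBall (0 : TridiagNewton.Omega P.s) r, ∀ k : ℕ,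
          |z.seq k - P.A (P.Adag z.seq) k| ≤ P.Z1 M r k ∧
          |P.A ((fderiv ℝ (fun x : TridiagNewton.Omega P.s => TridiagNewton.Omega.mk (P.f x.seq) (hf x))
              (P.xbarOmega + y) z).seq - P.Adag z.seq) k| ≤ P.Z2 M r k ∧
          |(fderiv ℝ (fun x : TridiagNewton.Omega P.s => TridiagNewton.Omega.mk (P.T x.seq) (hT x))
              (P.xbarOmega + y) z).seq k| ≤ P.Z M r k :=
  let ⟨hf, hT, hf', hT', hbounds⟩ := mainTheorem4_general P C2 k0 hs hsL.le
    (hg.of_exponent_le (sub_le_self _ hsL.le)) hA hk0 hm hN M hMA hMY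
  ⟨hf, hT, hf', hT', fun r _ => hbounds r⟩
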